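/- Let $V\subset\mathbb{C}^n$ be a nonempty affine variety (the common zero set of finitely many polynomials, possibly reducible) of dimension $\delta$ and degree $D$, where $D$ is $\delta!$ times the leading coefficient of the Hilbert polynomial of $V$, that is, the number of points in which $V$ meets a generic affine subspace of codimension $\delta$. For $c=(c_0,\dots,c_n)$ put $H_c=\{x\in\mathbb{C}^n : c_0+\sum_{i=1}^n c_ix_i=0\}$, and let $\dim\emptyset=-1$. (1) Let $S\subset\mathbb{C}$ be a finite nonempty set with $0\notin S$. If $c_0,\dots,c_n$ are chosen independently and uniformly at random from $S$, then $$\Pr[\dim(V\cap H_c)=\delta-1]\ \ge\ 1-\frac{D}{|S|}.$$ (2) For every real constant $\kappa\ge 2$ there are integers $c_0,\dots,c_n$, each of bitsize (number of binary digits of the absolute value) $\lceil \log_2(2\kappa D)\rceil+1$, such that $\dim(V\cap H_c)=\delta-1$. -/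

import Mathlib

/-- An affine variety in `ℂⁿ`: the common zero set of an ideal of polynomials (it may be
reducible). -/
def IsAffineVariety {n : ℕ} (V : Set (Fin n → ℂ)) : Prop :=
  ∃ I : Ideal (MvPolynomial (Fin n) ℂ), V = MvPolynomial.zeroLocus ℂ I

/-- The coordinate ring `ℂ[x₁, …, xₙ] / I(V)`. -/
abbrev CoordRing {n : ℕ} (V : Set (Fin n → ℂ)) : Type :=
  MvPolynomial (Fin n) ℂ ⧸ MvPolynomial.vanishingIdeal ℂ V

/-- The dimension of `V`: the Krull dimension of its coordinate ring, with the convention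
`dim ∅ = -1`. The Krull dimension is at most `n`, so that no junk value is involved: see
`ringKrullDim_coordRing`. -/
noncomputable def affineDim {n : ℕ} (V : Set (Fin n → ℂ)) : ℤ :=
  open Classical in
  if V = ∅ then -1 else ((ringKrullDim (CoordRing V)).unbotD 0).toNat

theorem ringKrullDim_coordRing {n : ℕ} {V : Set (Fin n → ℂ)} (hV : V.Nonempty) (d : ℕ) :
    affineDim V = d ↔ ringKrullDim (CoordRing V) = d := by
  obtain ⟨x, hx⟩ := hV
  have : Nontrivial (CoordRing V) := by
    apply Ideal.Quotient.nontrivial_iff.mpr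
    intro h
    have h1 : (1 : MvPolynomial (Fin n) ℂ) ∈ MvPolynomial.vanishingIdeal ℂ V := by
      rw [h]; trivial
    simpa using h1 x hx
  have h0 : (0 : WithBot ℕ∞) ≤ ringKrullDim (CoordRing V) := ringKrullDim_nonneg_of_nontrivial
  have h1 : ringKrullDim (CoordRing V) ≤ n := by
    refine (ringKrullDim_quotient_le _).trans ?_
    simp [MvPolynomial.ringKrullDim_of_isNoetherianRing]
  have hne : V ≠ ∅ := Set.nonempty_iff_ne_empty.mp ⟨x, hx⟩
  unfold affineDim
  rw [if_neg hne]
  generalize ringKrullDim (CoordRing V) = k at h0 h1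
  induction k with
  | bot => simp at h0
  | coe k =>
    induction k with
    | top =>
      have h2 : (⊤ : ℕ∞) ≤ n := by exact_mod_cast h1
      simp at h2
    | coe k =>
      simp only [WithBot.unbotD_coe, ENat.toNat_natCast, Nat.cast_inj]
      norm_cast

/-- The affine Hilbert function of `V`: the dimension of the space of polynomial functions on `V`
that are given by polynomials of total degree at most `s`. -/
noncomputable def hilbertFn {n : ℕ} (V : Set (Fin n → ℂ)) (s : ℕ) : ℕ :=
  Module.finrank ℂ ((MvPolynomial.restrictTotalDegree (Fin n) ℂ s).map
    (Ideal.Quotient.mkₐ ℂ (MvPolynomial.vanishingIdeal ℂ V)).toLinearMap)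

/-- The degree of a (nonempty) affine variety `V` of dimension `δ`: `δ!` times the leading
coefficient of its Hilbert polynomial, that is `lim δ! * HF_V(s) / s ^ δ` as `s → ∞`. It is the
number of points in which `V` meets a generic affine subspace of codimension `δ`. For large `s`
the Hilbert function is a polynomial of degree `δ` in `s`, so the limit exists and equals the
upper limit. -/
noncomputable def affineDegree {n : ℕ} (V : Set (Fin n → ℂ)) : ℝ :=
  Filter.limsup (fun s : ℕ =>
    ((affineDim V).toNat.factorial : ℝ) * hilbertFn V s / (s : ℝ) ^ (affineDim V).toNat)
    Filter.atTop

/-- The affine form `h = c₀ + c₁ x₁ + ⋯ + cₙ xₙ`. -/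
noncomputable def affineForm {n : ℕ} (c : Fin (n + 1) → ℂ) : MvPolynomial (Fin n) ℂ :=
  MvPolynomial.C (c 0) + ∑ i : Fin n, MvPolynomial.C (c i.succ) * MvPolynomial.X i

/-- The zero set of the affine form with coefficients `c`. -/
def affineHyperplane {n : ℕ} (c : Fin (n + 1) → ℂ) : Set (Fin n → ℂ) :=
  {x | MvPolynomial.eval x (affineForm c) = 0}

/-- The law of `n + 1` coefficients chosen independently and uniformly at random from `S`. -/
noncomputable def randomCoeffs (n : ℕ) (S : Finset ℂ) : MeasureTheory.Measure (Fin (n + 1) → ℂ) :=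
  MeasureTheory.Measure.pi fun _ => ProbabilityTheory.uniformOn (S : Set ℂ)

/-- The bitsize of an integer: the number of binary digits of its absolute value. -/
def bitsize (a : ℤ) : ℕ := a.natAbs.size

/-!
Let `I` be the vanishing ideal of `V` and `P = ℂ[x₁, …, xₙ]`, so that `dim P ⧸ I = δ`.

Suppose first that `δ ≥ 1`. The ideal `in(I)` of initial (highest-degree) forms of `I` defines the
cone over the points at infinity of the closure of `V`. It has the same Hilbert function as `I`, and
hence dimension at most `δ` (`ringKrullDim_quotient_initialForms_le`). Let `Q₁, …, Q_k` be the
minimal primes of `in(I)` of dimension `δ`. If the linear part `ℓ = c₁ x₁ + ⋯ + cₙ xₙ` lies in none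
of them, then `dim P ⧸ (in(I) + ℓ) ≤ δ - 1`, and `ℓ` extends to a linear system of parameters
`ℓ, y₂, …, y_δ` of the graded ring `P ⧸ in(I)`. Lifting from initial forms to `I`, the ring `P ⧸ I`
is finite over `ℂ[ℓ, y₂, …, y_δ]`, which is then a polynomial ring because the dimensions agree, and
going-up shows that setting `ℓ = -c₀` drops the dimension by exactly one, for *every* `c₀`
(`ringKrullDim_quotient_sup_span_linearForm_add_C`). No separate discussion is needed of components
contained in the hyperplane and of components that meet it only at infinity.

The number `k` is at most the degree (`card_le_limsup_of_hilbertFn_le`): each `P ⧸ Q_j` contains a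
polynomial ring in `δ` of the variables, so its Hilbert function is at least `s ^ δ / δ!`, and the
Hilbert functions of incomparable primes over the same ideal add up to at most the Hilbert function
of that ideal, after a shift of the degree.

Since `Q_j` has positive dimension it misses some variable, so `ℓ ∈ Q_j` is a proper linear
condition on the coefficients, which holds for at most one choice in `|S|` of a suitable coefficient. The
union bound gives the first part. For the second part one takes for `S` the `2 ^ b` positive
integers with `b + 1` binary digits, where `2 ^ b ≥ 2κD > k`. For `δ = 0` the same argument applies to the
minimal primes of `I` and the whole affine form, a component being good if it misses the hyperplane.
-/

open MvPolynomial

/-! ### Krull dimension of integral extensions -/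

theorem RingHom.IsIntegral.ringKrullDim_le {A B : Type*} [CommRing A] [CommRing B]
    {f : A →+* B} (hf : f.IsIntegral) : ringKrullDim B ≤ ringKrullDim A := by
  algebraize [f]
  refine Order.krullDim_le_of_strictMono (PrimeSpectrum.comap (algebraMap A B)) fun p q h => ?_
  exact Ideal.IsIntegral.comap_lt_comap (R := A) (I := p.asIdeal) (J := q.asIdeal) h

theorem RingHom.IsIntegral.ringKrullDim_eq {A B : Type*} [CommRing A] [CommRing B]
    {f : A →+* B} (hf : f.IsIntegral) (hinj : Function.Injective f) :
    ringKrullDim B = ringKrullDim A := by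
  refine le_antisymm hf.ringKrullDim_le ?_
  algebraize [f]
  refine iSup_le fun l => ?_
  obtain ⟨P, -, hP, hPl⟩ := Ideal.exists_ideal_over_prime_of_isIntegral
    l.head.asIdeal (⊥ : Ideal B) (by
      rw [← RingHom.ker_eq_comap_bot]
      exact ((RingHom.injective_iff_ker_eq_bot _).1 hinj).le.trans bot_le)
  have : P.LiesOver l.head.asIdeal := ⟨hPl.symm⟩
  obtain ⟨L, hL, -⟩ := Ideal.exists_ltSeries_of_hasGoingUp (S := B) l P
  rw [← hL]
  exact le_iSup (fun L : LTSeries (PrimeSpectrum B) => (L.length : WithBot ℕ∞)) L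

/-- Lying over shows that `A ⧸ J → B ⧸ JB` is still injective, because `J` is prime. -/
theorem RingHom.IsIntegral.ringKrullDim_quotient_map {A B : Type*} [CommRing A] [CommRing B]
    {f : A →+* B} (hf : f.IsIntegral) (hinj : Function.Injective f) (J : Ideal A) [J.IsPrime] :
    ringKrullDim (B ⧸ J.map f) = ringKrullDim (A ⧸ J) := by
  have hle : J ≤ (J.map f).comap f := Ideal.le_comap_map
  refine RingHom.IsIntegral.ringKrullDim_eq (f := Ideal.quotientMap (J.map f) f hle) ?_ ?_
  · intro x
    obtain ⟨b, rfl⟩ := Ideal.Quotient.mk_surjective x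
    obtain ⟨p, hp, hpb⟩ := hf b
    refine ⟨p.map (Ideal.Quotient.mk J), hp.map _, ?_⟩
    rw [Polynomial.eval₂_map, Ideal.quotientMap_comp_mk, ← Polynomial.hom_eval₂, hpb, map_zero]
  · refine Ideal.quotientMap_injective' ?_
    algebraize [f]
    obtain ⟨Q, -, hQ, hQJ⟩ := Ideal.exists_ideal_over_prime_of_isIntegral
      J (⊥ : Ideal B) (by
        rw [← RingHom.ker_eq_comap_bot]
        exact ((RingHom.injective_iff_ker_eq_bot _).1 hinj).le.trans bot_le)
    refine le_trans ?_ hQJ.le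
    exact Ideal.comap_mono (f := f) (Ideal.map_le_iff_le_comap.2 hQJ.symm.le)

theorem ringKrullDim_quotient_le_of_forall_isPrime {R : Type*} [CommRing R] {J : Ideal R}
    {d : WithBot ℕ∞} (h : ∀ Q : Ideal R, Q.IsPrime → J ≤ Q → ringKrullDim (R ⧸ Q) ≤ d) :
    ringKrullDim (R ⧸ J) ≤ d := by
  refine iSup_le fun l => ?_
  have hker : J ≤ l.head.asIdeal.comap (Ideal.Quotient.mk J) :=
    (Ideal.mk_ker (I := J)).symm.le.trans (Ideal.comap_mono bot_le)
  refine le_trans ?_ (h (l.head.asIdeal.comap (Ideal.Quotient.mk J)) inferInstance hker)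
  rw [ringKrullDim_quotient]
  let e : PrimeSpectrum (R ⧸ J) → PrimeSpectrum R := PrimeSpectrum.comap (Ideal.Quotient.mk J)
  have he : StrictMono e := fun p q hpq =>
    lt_of_le_of_ne (Ideal.comap_mono hpq.le) fun h => hpq.ne
      (PrimeSpectrum.comap_injective_of_surjective _ Ideal.Quotient.mk_surjective h)
  let L : LTSeries (PrimeSpectrum.zeroLocus
      (l.head.asIdeal.comap (Ideal.Quotient.mk J) : Set R)) :=
    { length := l.length
      toFun := fun i => ⟨e (l i), by
        rw [PrimeSpectrum.mem_zeroLocus]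
        exact Ideal.comap_mono (l.head_le i)⟩
      step := fun i => he (l.step i) }
  exact le_iSup (fun L : LTSeries _ => (L.length : WithBot ℕ∞)) L

theorem ringKrullDim_quotient_anti {R : Type*} [CommRing R] {I J : Ideal R} (h : I ≤ J) :
    ringKrullDim (R ⧸ J) ≤ ringKrullDim (R ⧸ I) :=
  ringKrullDim_le_of_surjective _ (Ideal.Quotient.factor_surjective h)

theorem ringKrullDim_quotient_add_one_le_of_lt {R : Type*} [CommRing R] {P Q : Ideal R}
    [P.IsPrime] (h : P < Q) : ringKrullDim (R ⧸ Q) + 1 ≤ ringKrullDim (R ⧸ P) := by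
  obtain ⟨x, hxQ, hxP⟩ := SetLike.exists_of_lt h
  refine ringKrullDim_succ_le_of_surjective (r := Ideal.Quotient.mk P x)
    (Ideal.Quotient.factor h.le) (Ideal.Quotient.factor_surjective h.le) ?_ ?_
  · exact mem_nonZeroDivisors_of_ne_zero (by rwa [Ne, Ideal.Quotient.eq_zero_iff_mem])
  · simpa [Ideal.Quotient.eq_zero_iff_mem] using hxQ

theorem ringKrullDim_quotient_radical {R : Type*} [CommRing R] (I : Ideal R) :
    ringKrullDim (R ⧸ I.radical) = ringKrullDim (R ⧸ I) := by
  rw [ringKrullDim_quotient, ringKrullDim_quotient, PrimeSpectrum.zeroLocus_radical]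

theorem eq_bot_or_eq_natCast_of_le_natCast {x : WithBot ℕ∞} {N : ℕ} (h : x ≤ N) :
    x = ⊥ ∨ ∃ d : ℕ, d ≤ N ∧ x = d := by
  induction x with
  | bot => simp
  | coe k =>
    induction k with
    | top =>
      have h2 : (⊤ : ℕ∞) ≤ N := by exact_mod_cast h
      simp at h2
    | coe k => exact Or.inr ⟨k, by exact_mod_cast h, rfl⟩

/-! ### Polynomial rings over a field -/

section Field

variable {K : Type*} [Field K]

theorem ringKrullDim_mvPolynomial_fin (d : ℕ) : ringKrullDim (MvPolynomial (Fin d) K) = d := by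
  simp [MvPolynomial.ringKrullDim_of_isNoetherianRing]

/-- A quotient of `K[Y₀, …, Y_d]` by a hyperplane `Y₀ + c` is a polynomial ring. -/
theorem exists_quotient_X_zero_add_C_equiv (d : ℕ) (c : K) :
    Nonempty ((MvPolynomial (Fin (d + 1)) K ⧸
      Ideal.span {(X 0 + C c : MvPolynomial (Fin (d + 1)) K)}) ≃+* MvPolynomial (Fin d) K) := by
  let e := (finSuccEquiv K d).toRingEquiv
  have he : e (X 0 + C c) = Polynomial.X - Polynomial.C (-C c) := by
    simp [e, finSuccEquiv_apply]
  refine ⟨(Ideal.quotientEquiv _ (Ideal.span {Polynomial.X - Polynomial.C (-C c)}) e ?_).trans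
    (Polynomial.quotientSpanXSubCAlgEquiv (-C c : MvPolynomial (Fin d) K)).toRingEquiv⟩
  rw [Ideal.map_span, Set.image_singleton]
  exact congrArg (fun p => Ideal.span {p}) he.symm

/-- If `B` has dimension `d + 1` and is integral over `K[Y₀, …, Y_d]`, then cutting `B` by
`Y₀ + c` drops the dimension by exactly one, for every constant `c`. -/
theorem ringKrullDim_quotient_of_isIntegral {B : Type*} [CommRing B] {d : ℕ}
    (φ : MvPolynomial (Fin (d + 1)) K →+* B) (hφ : φ.IsIntegral)
    (hB : ringKrullDim B = (d + 1 : ℕ)) (c : K) :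
    ringKrullDim (B ⧸ Ideal.span {φ (X 0 + C c)}) = d := by
  -- otherwise `B` would be integral over a proper quotient of the polynomial ring
  have hinj : Function.Injective φ := by
    rw [RingHom.injective_iff_ker_eq_bot]
    by_contra hne
    have h1 : ringKrullDim B ≤ ringKrullDim (MvPolynomial (Fin (d + 1)) K ⧸ RingHom.ker φ) := by
      refine RingHom.IsIntegral.ringKrullDim_le (f := RingHom.kerLift φ) ?_
      refine RingHom.IsIntegral.tower_top (Ideal.Quotient.mk (RingHom.ker φ)) _ ?_
      convert hφ using 1
      ext <;> rfl
    have h2 := ringKrullDim_quotient_add_one_le_of_lt (bot_lt_iff_ne_bot.2 hne)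
    have h3 : ringKrullDim (MvPolynomial (Fin (d + 1)) K ⧸ RingHom.ker φ) + 1 ≤ (d + 1 : ℕ) := by
      refine h2.trans ?_
      exact (ringKrullDim_quotient_le _).trans (ringKrullDim_mvPolynomial_fin _).le
    have h4 : ((d + 1 : ℕ) : WithBot ℕ∞) + 1 ≤ (d + 1 : ℕ) :=
      (add_le_add_left (hB.symm.le.trans h1) 1).trans h3
    have h5 : d + 1 + 1 ≤ d + 1 := by exact_mod_cast h4
    omega
  obtain ⟨e⟩ := exists_quotient_X_zero_add_C_equiv d c
  have : (Ideal.span {(X 0 + C c : MvPolynomial (Fin (d + 1)) K)}).IsPrime := by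
    rw [← Ideal.Quotient.isDomain_iff_prime]
    exact e.toMulEquiv.isDomain _
  have h := hφ.ringKrullDim_quotient_map hinj (Ideal.span {X 0 + C c})
  rw [Ideal.map_span, Set.image_singleton] at h
  rw [h, ringKrullDim_eq_of_ringEquiv e, ringKrullDim_mvPolynomial_fin]

/-- The dimension of an affine domain is the number of algebraically independent elements among
any generators. -/
theorem exists_algebraicIndependent_X {n : ℕ} (Q : Ideal (MvPolynomial (Fin n) K)) [Q.IsPrime]
    {d : ℕ} (hd : ringKrullDim (MvPolynomial (Fin n) K ⧸ Q) = d) :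
    ∃ t : Fin d → Fin n, AlgebraicIndependent K fun j => Ideal.Quotient.mkₐ K Q (X (t j)) := by
  obtain ⟨s, -, g, hg, hint⟩ :=
    exists_integral_inj_algHom_of_quotient Q (Ideal.IsPrime.ne_top inferInstance)
  have hs : s = d := by
    have := RingHom.IsIntegral.ringKrullDim_eq (f := g.toRingHom) hint hg
    rw [hd, ringKrullDim_mvPolynomial_fin] at this
    exact_mod_cast this.symm
  subst hs
  let B := MvPolynomial (Fin n) K ⧸ Q
  algebraize [g.toRingHom]
  have : IsScalarTower K (MvPolynomial (Fin s) K) B := IsScalarTower.of_algHom g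
  have : FaithfulSMul (MvPolynomial (Fin s) K) B :=
    (faithfulSMul_iff_algebraMap_injective _ _).2 hg
  have htr : Algebra.trdeg K B = s := by
    rw [← trdeg_add_eq K (MvPolynomial (Fin s) K) (A := B),
      trdeg_eq_zero (R := MvPolynomial (Fin s) K)]
    simp
  let x : Fin n → B := fun i => Ideal.Quotient.mkₐ K Q (X i)
  have hx : Algebra.adjoin K (Set.range x) = ⊤ := by
    have : Set.range x = Ideal.Quotient.mkₐ K Q '' Set.range X := by
      rw [← Set.range_comp]; rfl
    rw [this, ← AlgHom.map_adjoin, adjoin_range_X, Algebra.map_top, AlgHom.range_eq_top]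
    exact Ideal.Quotient.mkₐ_surjective K Q
  have : Algebra.IsAlgebraic (Algebra.adjoin K (Set.range x)) B := by
    rw [hx]
    exact ⟨fun b => isAlgebraic_algebraMap (⟨b, trivial⟩ : (⊤ : Subalgebra K B))⟩
  obtain ⟨u, hu, hub⟩ := exists_isTranscendenceBasis_subset (R := K) (Set.range x)
  have hcard : Cardinal.mk u = s := hub.cardinalMk_eq_trdeg.trans htr
  have hfin : Finite u := (Set.finite_range x).subset hu
  have : Fintype u := Fintype.ofFinite u
  have e : Fin s ≃ u := (Fintype.equivFinOfCardEq (by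
    rw [Cardinal.mk_fintype] at hcard; exact_mod_cast hcard)).symm
  choose t ht using fun j => hu (e j).2
  refine ⟨t, ?_⟩
  have := hub.1.comp e e.injective
  convert this using 1
  ext j
  exact ht j

/-! ### Hilbert functions of ideals -/

/-- The affine Hilbert function of an ideal `J` of `K[x₁, …, xₙ]`: the dimension of the space of
residue classes modulo `J` of polynomials of total degree at most `s`. -/
noncomputable def Ideal.hilbertFn {n : ℕ} (J : Ideal (MvPolynomial (Fin n) K)) (s : ℕ) : ℕ :=
  Module.finrank K ((restrictTotalDegree (Fin n) K s).map (Ideal.Quotient.mkₐ K J).toLinearMap)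

theorem hilbertFn_anti {n : ℕ} {I J : Ideal (MvPolynomial (Fin n) K)} (h : I ≤ J) (s : ℕ) :
    J.hilbertFn s ≤ I.hilbertFn s := by
  have : (restrictTotalDegree (Fin n) K s).map (Ideal.Quotient.mkₐ K J).toLinearMap =
      ((restrictTotalDegree (Fin n) K s).map (Ideal.Quotient.mkₐ K I).toLinearMap).map
        (Ideal.Quotient.factorₐ K h).toLinearMap := by
    rw [← Submodule.map_comp]; rfl
  rw [Ideal.hilbertFn, this]
  exact Submodule.finrank_map_le _ _

theorem finrank_restrictTotalDegree (d s : ℕ) :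
    Module.finrank K (restrictTotalDegree (Fin d) K s) = (d + s).choose d := by
  classical
  have hset : {e : Fin d →₀ ℕ | (e.sum fun _ e => e) ≤ s} =
      ((Finset.range (s + 1)).biUnion fun t => Finset.univ.finsuppAntidiag t :
        Finset (Fin d →₀ ℕ)) := by
    ext e
    simp [Finset.mem_finsuppAntidiag, Finsupp.sum_fintype]
  have hdisj : ((Finset.range (s + 1) : Finset ℕ) : Set ℕ).PairwiseDisjoint
      fun t => (Finset.univ.finsuppAntidiag t : Finset (Fin d →₀ ℕ)) := by
    intro a _ b _ hab
    refine Finset.disjoint_left.2 fun e ha hb => hab ?_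
    rw [Finset.mem_finsuppAntidiag] at ha hb
    exact ha.1.symm.trans hb.1
  have h1 := Module.finrank_eq_nat_card_basis
    (basisRestrictSupport K {e : Fin d →₀ ℕ | (e.sum fun _ e => e) ≤ s})
  rw [restrictTotalDegree, h1, Nat.card_coe_set_eq, hset, Set.ncard_coe_finset,
    Finset.card_biUnion hdisj]
  simp only [Finset.card_finsuppAntidiag_nat_eq_multichoose, Finset.card_univ, Fintype.card_fin]
  rw [Nat.sum_range_multichoose, add_comm s d, Nat.choose_symm_add]

theorem pow_le_factorial_mul_finrank_restrictTotalDegree (d s : ℕ) :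
    (s + 1) ^ d ≤ d.factorial * Module.finrank K (restrictTotalDegree (Fin d) K s) := by
  rw [finrank_restrictTotalDegree, add_comm d s, ← Nat.ascFactorial_eq_factorial_mul_choose]
  exact Nat.pow_succ_le_ascFactorial _ _

theorem finrank_restrictTotalDegree_le (d s : ℕ) :
    Module.finrank K (restrictTotalDegree (Fin d) K s) ≤ (s + 1) ^ d := by
  rw [finrank_restrictTotalDegree]
  induction d with
  | zero => simp
  | succ d ih =>
    have h := Nat.add_one_mul_choose_eq (d + s) d
    have h2 : (d + 1 + s).choose (d + 1) * (d + 1) ≤ (s + 1) ^ (d + 1) * (d + 1) := by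
      rw [show d + 1 + s = (d + s + 1) by omega, ← h, pow_succ]
      calc (d + s + 1) * (d + s).choose d ≤ ((s + 1) * (d + 1)) * (s + 1) ^ d :=
            Nat.mul_le_mul (by nlinarith) ih
        _ = _ := by ring
    exact Nat.le_of_mul_le_mul_right h2 (Nat.succ_pos d)

theorem pow_le_factorial_mul_hilbertFn {n : ℕ} (Q : Ideal (MvPolynomial (Fin n) K)) [Q.IsPrime]
    {d : ℕ} (hd : ringKrullDim (MvPolynomial (Fin n) K ⧸ Q) = d) (s : ℕ) :
    (s + 1) ^ d ≤ d.factorial * Q.hilbertFn s := by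
  obtain ⟨t, ht⟩ := exists_algebraicIndependent_X Q hd
  refine (pow_le_factorial_mul_finrank_restrictTotalDegree (K := K) d s).trans
    (Nat.mul_le_mul_left _ ?_)
  rw [algebraicIndependent_iff_injective_aeval] at ht
  have hcomp : (aeval fun j => Ideal.Quotient.mkₐ K Q (X (t j))) =
      (Ideal.Quotient.mkₐ K Q).comp (rename t) := by ext; simp
  let f := (aeval (R := K) fun j => Ideal.Quotient.mkₐ K Q (X (t j))).toLinearMap
  rw [LinearEquiv.finrank_eq (Submodule.equivMapOfInjective f ht _)]
  refine Submodule.finrank_mono ?_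
  rintro _ ⟨p, hp, rfl⟩
  refine ⟨rename t p, ?_, ?_⟩
  · rw [SetLike.mem_coe, mem_restrictTotalDegree] at hp ⊢
    exact (totalDegree_rename_le t p).trans hp
  · change _ = (aeval fun j => Ideal.Quotient.mkₐ K Q (X (t j))) p
    rw [hcomp]; rfl

/-- Hilbert functions add up over incomparable primes, up to a shift of the degree: if
`f_Q` lies in every prime of `F` except `Q`, multiplication by `(f_Q)_Q` embeds `∏ P ⧸ Q` into
itself, with image inside that of the diagonal map. -/
theorem exists_sum_hilbertFn_le {n : ℕ} {J : Ideal (MvPolynomial (Fin n) K)}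
    (F : Finset (Ideal (MvPolynomial (Fin n) K))) (hF : ∀ Q ∈ F, Q.IsPrime)
    (hJ : ∀ Q ∈ F, J ≤ Q) (hinc : ∀ Q ∈ F, ∀ Q' ∈ F, Q ≤ Q' → Q = Q') :
    ∃ c : ℕ, ∀ s, ∑ Q ∈ F, Q.hilbertFn s ≤ J.hilbertFn (s + c) := by
  classical
  have hex : ∀ Q : F, ∃ f : MvPolynomial (Fin n) K, f ∉ Q.1 ∧ ∀ Q' : F, Q' ≠ Q → f ∈ Q'.1 := by
    intro Q
    have := hF Q Q.2
    by_contra! hcon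
    have hle : ((F.erase Q.1).inf id) ≤ Q.1 := by
      intro f hf
      by_contra hfQ
      obtain ⟨Q', hne, hQ'⟩ := hcon f hfQ
      exact hQ' ((Finset.inf_le (f := id) (Finset.mem_erase.2
        ⟨fun h => hne (Subtype.ext h), Q'.2⟩)) hf)
    obtain ⟨Q', hQ', h⟩ := (Ideal.IsPrime.inf_le' inferInstance).1 hle
    exact (Finset.mem_erase.1 hQ').1 (hinc _ (Finset.mem_erase.1 hQ').2 _ Q.2 h)
  choose f hfQ hf using hex
  let c := Finset.univ.sup fun Q : F => (f Q).totalDegree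
  refine ⟨c, fun s => ?_⟩
  let W : (Q : F) → Submodule K (MvPolynomial (Fin n) K ⧸ Q.1) := fun Q =>
    (restrictTotalDegree (Fin n) K s).map (Ideal.Quotient.mkₐ K Q.1).toLinearMap
  let V := (restrictTotalDegree (Fin n) K (s + c)).map (Ideal.Quotient.mkₐ K J).toLinearMap
  let Δ : MvPolynomial (Fin n) K ⧸ J →ₗ[K] (Q : F) → MvPolynomial (Fin n) K ⧸ Q.1 :=
    LinearMap.pi fun Q => (Ideal.Quotient.factorₐ K (hJ Q.1 Q.2)).toLinearMap
  let M : ((Q : F) → W Q) →ₗ[K] (Q : F) → MvPolynomial (Fin n) K ⧸ Q.1 :=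
    LinearMap.pi fun Q => (LinearMap.mulLeft K (Ideal.Quotient.mkₐ K Q.1 (f Q))).comp
      ((W Q).subtype.comp (LinearMap.proj Q))
  have hM : Function.Injective M := by
    rw [injective_iff_map_eq_zero]
    intro w hw
    ext Q
    obtain ⟨p, hp⟩ := Ideal.Quotient.mk_surjective (w Q).1
    have h1 : Ideal.Quotient.mk Q.1 (f Q) * (w Q).1 = 0 := congrFun hw Q
    rw [← hp, ← map_mul, Ideal.Quotient.eq_zero_iff_mem] at h1
    change (w Q).1 = 0
    rw [← hp, Ideal.Quotient.eq_zero_iff_mem]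
    exact ((hF Q Q.2).mem_or_mem h1).resolve_left (hfQ Q)
  have hle : LinearMap.range M ≤ V.map Δ := by
    rintro _ ⟨w, rfl⟩
    choose p hp hpw using fun Q => (w Q).2
    refine ⟨_, ⟨∑ Q, f Q * p Q, ?_, rfl⟩, ?_⟩
    · rw [SetLike.mem_coe, mem_restrictTotalDegree]
      refine totalDegree_finsetSum_le fun Q _ => (totalDegree_mul _ _).trans ?_
      rw [add_comm s]
      refine add_le_add (Finset.le_sup (f := fun Q : F => (f Q).totalDegree)
        (Finset.mem_univ Q)) ?_
      exact (mem_restrictTotalDegree _ _ _).1 (hp Q)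
    · funext Q
      change Ideal.Quotient.mk Q.1 (∑ Q, f Q * p Q) = Ideal.Quotient.mk Q.1 (f Q) * (w Q).1
      rw [← hpw Q, map_sum, Finset.sum_eq_single Q]
      · exact map_mul _ _ _
      · intro Q' _ hne
        rw [Ideal.Quotient.eq_zero_iff_mem]
        exact Ideal.mul_mem_right _ _ (hf Q' Q hne.symm)
      · exact fun h => absurd (Finset.mem_univ Q) h
  have hfree : ∀ Q, Module.Free K (W Q) := fun Q => Module.Free.of_divisionRing K _
  have hfin : ∀ Q, Module.Finite K (W Q) := fun Q => inferInstance
  have h1 : Module.finrank K ((Q : F) → W Q) = ∑ Q ∈ F, Q.hilbertFn s := by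
    rw [Module.finrank_pi_fintype, ← Finset.sum_coe_sort F]
    rfl
  rw [← h1, ← LinearMap.finrank_range_of_inj hM]
  exact (Submodule.finrank_mono hle).trans (Submodule.finrank_map_le _ _)

/-- If `B` is generated as a module over `K[Y₁, …, Y_δ]` by finitely many elements `m_k`, then
the images of polynomials of degree at most `s` are combinations of the `m_k` with coefficients of
degree at most `e (s + 1)`, for a suitable `e`. -/
theorem exists_finrank_map_restrictTotalDegree_le {n δ : ℕ} {B : Type*} [CommRing B] [Algebra K B]
    [Algebra (MvPolynomial (Fin δ) K) B] [IsScalarTower K (MvPolynomial (Fin δ) K) B]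
    [Module.Finite (MvPolynomial (Fin δ) K) B] (π : MvPolynomial (Fin n) K →ₐ[K] B) :
    ∃ C : ℕ, ∀ s, Module.finrank K ((restrictTotalDegree (Fin n) K s).map π.toLinearMap) ≤
      C * (s + 1) ^ δ := by
  obtain ⟨r, m, hm⟩ := Module.Finite.exists_fin
    (R := MvPolynomial (Fin δ) K) (M := B)
  have hm' : ∀ b : B, ∃ a : Fin r → MvPolynomial (Fin δ) K,
      ∑ k, a k • m k = b := fun b =>
    (Submodule.mem_span_range_iff_exists_fun _).1 (hm ▸ Submodule.mem_top)
  let Φ : (Fin r → MvPolynomial (Fin δ) K) →ₗ[K] B :=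
    { toFun := fun a => ∑ k, a k • m k
      map_add' := fun a b => by simp [add_smul, Finset.sum_add_distrib]
      map_smul' := fun c a => by simp [Finset.smul_sum] }
  let Ψ : (D : ℕ) → (Fin r → restrictTotalDegree (Fin δ) K D) →ₗ[K] B :=
    fun D => Φ ∘ₗ LinearMap.compLeft (restrictTotalDegree (Fin δ) K D).subtype (Fin r)
  have hΨ : ∀ D b, b ∈ LinearMap.range (Ψ D) ↔
      ∃ a : Fin r → MvPolynomial (Fin δ) K, (∀ k, (a k).totalDegree ≤ D) ∧
        ∑ k, a k • m k = b := by
    intro D b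
    constructor
    · rintro ⟨a, rfl⟩
      exact ⟨fun k => a k, fun k => (mem_restrictTotalDegree _ _ _).1 (a k).2, rfl⟩
    · rintro ⟨a, ha, rfl⟩
      exact ⟨fun k => ⟨a k, (mem_restrictTotalDegree _ _ _).2 (ha k)⟩, rfl⟩
  have hmono : ∀ D E, D ≤ E → LinearMap.range (Ψ D) ≤ LinearMap.range (Ψ E) := by
    intro D E h b hb
    obtain ⟨a, ha, rfl⟩ := (hΨ _ _).1 hb
    exact (hΨ _ _).2 ⟨a, fun k => (ha k).trans h, rfl⟩
  obtain ⟨a₁, ha₁⟩ := hm' 1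
  choose p hp using fun (i : Fin n) (k : Fin r) => hm' (π (X i) * m k)
  let e := max (Finset.univ.sup fun k => (a₁ k).totalDegree)
    (Finset.univ.sup fun i => Finset.univ.sup fun k => Finset.univ.sup fun l =>
      (p i k l).totalDegree)
  have he₁ : ∀ k, (a₁ k).totalDegree ≤ e := fun k =>
    (Finset.le_sup (f := fun k => (a₁ k).totalDegree) (Finset.mem_univ k)).trans (le_max_left _ _)
  have he₂ : ∀ i k l, (p i k l).totalDegree ≤ e := fun i k l =>
    ((Finset.le_sup (f := fun l => (p i k l).totalDegree) (Finset.mem_univ l)).trans <|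
      (Finset.le_sup (f := fun k => Finset.univ.sup fun l => (p i k l).totalDegree)
        (Finset.mem_univ k)).trans <|
      Finset.le_sup (f := fun i => Finset.univ.sup fun k => Finset.univ.sup fun l =>
        (p i k l).totalDegree) (Finset.mem_univ i)).trans (le_max_right _ _)
  -- `e` bounds the degrees of the coefficients of `1` and of all products `x_i m_k`
  have hX : ∀ i D b, b ∈ LinearMap.range (Ψ D) →
      π (X i) * b ∈ LinearMap.range (Ψ (D + e)) := by
    intro i D b hb
    obtain ⟨a, ha, rfl⟩ := (hΨ _ _).1 hb
    refine (hΨ _ _).2 ⟨fun l => ∑ k, a k * p i k l, fun l => ?_, ?_⟩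
    · exact totalDegree_finsetSum_le fun k _ =>
        (totalDegree_mul _ _).trans (add_le_add (ha k) (he₂ i k l))
    · simp_rw [Finset.sum_smul, Finset.mul_sum, mul_smul_comm, ← hp, Finset.smul_sum, mul_smul]
      exact Finset.sum_comm
  have hmon : ∀ (t : ℕ) (v : Fin n →₀ ℕ), v.degree = t →
      π (monomial v 1) ∈ LinearMap.range (Ψ (e * (t + 1))) := by
    intro t
    induction t with
    | zero =>
      intro v hv
      rw [Finsupp.degree_eq_zero_iff] at hv
      subst hv
      exact (hΨ _ _).2 ⟨a₁, fun k => by simpa using he₁ k, ha₁.trans (map_one π).symm⟩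
    | succ t ih =>
      intro v hv
      have hne : v ≠ 0 := by rintro rfl; simp at hv
      obtain ⟨i, hi⟩ := Finsupp.ne_iff.1 hne
      have hle : Finsupp.single i 1 ≤ v := by
        rw [Finsupp.single_le_iff]; exact Nat.one_le_iff_ne_zero.2 hi
      have hv' : v = Finsupp.single i 1 + (v - Finsupp.single i 1) :=
        (add_tsub_cancel_of_le hle).symm
      have hdeg : (v - Finsupp.single i 1).degree = t := by
        have := congrArg Finsupp.degree hv'
        rw [map_add, hv, Finsupp.degree_single] at this
        omega
      have hmul : (monomial v 1 : MvPolynomial (Fin n) K) =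
          X i * monomial (v - Finsupp.single i 1) 1 := by
        rw [X, monomial_mul, one_mul, ← hv']
      rw [hmul, map_mul, mul_add_one e (t + 1)]
      exact hX i _ _ (ih _ hdeg)
  have hle : ∀ s, (restrictTotalDegree (Fin n) K s).map (π).toLinearMap ≤
      LinearMap.range (Ψ (e * (s + 1))) := by
    rintro s _ ⟨q, hq, rfl⟩
    rw [SetLike.mem_coe, mem_restrictTotalDegree] at hq
    have hsum : π q = ∑ v ∈ q.support, coeff v q • π (monomial v 1) := by
      conv_lhs => rw [q.as_sum, map_sum]
      refine Finset.sum_congr rfl fun v _ => ?_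
      rw [← map_smul, smul_monomial, smul_eq_mul, mul_one]
    rw [AlgHom.toLinearMap_apply, hsum]
    refine Submodule.sum_mem _ fun v hv => ?_
    refine Submodule.smul_mem _ _ (hmono _ _ ?_ (hmon _ v rfl))
    exact Nat.mul_le_mul_left _ (Nat.succ_le_succ ((le_totalDegree hv).trans hq))
  refine ⟨r * (e + 1) ^ δ, fun s => ?_⟩
  calc Module.finrank K ((restrictTotalDegree (Fin n) K s).map π.toLinearMap) ≤
      Module.finrank K (LinearMap.range (Ψ (e * (s + 1)))) :=
        Submodule.finrank_mono (hle s)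
    _ ≤ Module.finrank K (Fin r → restrictTotalDegree (Fin δ) K (e * (s + 1))) :=
        LinearMap.finrank_range_le _
    _ = r * Module.finrank K (restrictTotalDegree (Fin δ) K (e * (s + 1))) := by
        rw [Module.finrank_pi_fintype]; simp
    _ ≤ r * (e * (s + 1) + 1) ^ δ := Nat.mul_le_mul_left _ (finrank_restrictTotalDegree_le _ _)
    _ ≤ r * ((e + 1) * (s + 1)) ^ δ := by gcongr; nlinarith
    _ = _ := by rw [mul_pow]; ring

theorem exists_hilbertFn_le {n d : ℕ} (J : Ideal (MvPolynomial (Fin n) K))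
    (hd : ringKrullDim (MvPolynomial (Fin n) K ⧸ J) = d) :
    ∃ C : ℕ, ∀ s, J.hilbertFn s ≤ C * (s + 1) ^ d := by
  have hJ : J ≠ ⊤ := by
    rintro rfl
    rw [ringKrullDim_eq_bot_of_subsingleton] at hd
    exact WithBot.bot_ne_coe hd
  obtain ⟨δ, -, g, hg, hint⟩ := exists_integral_inj_algHom_of_quotient J hJ
  have hδ : δ = d := by
    have := RingHom.IsIntegral.ringKrullDim_eq (f := g.toRingHom) hint hg
    rw [hd, ringKrullDim_mvPolynomial_fin] at this
    exact_mod_cast this.symm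
  subst hδ
  have hfin : g.toRingHom.Finite := by
    refine hint.to_finite (RingHom.FiniteType.of_comp_finiteType
      (f := algebraMap K (MvPolynomial (Fin δ) K)) ?_)
    rw [show g.toRingHom.comp (algebraMap K (MvPolynomial (Fin δ) K)) =
      algebraMap K (MvPolynomial (Fin n) K ⧸ J) from g.comp_algebraMap]
    exact RingHom.finiteType_algebraMap.mpr inferInstance
  algebraize [g.toRingHom]
  have : IsScalarTower K (MvPolynomial (Fin δ) K) (MvPolynomial (Fin n) K ⧸ J) :=
    IsScalarTower.of_algHom g
  exact exists_finrank_map_restrictTotalDegree_le (Ideal.Quotient.mkₐ K J)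

/-! ### The ideal of initial forms -/

theorem homogeneousComponent_of_isHomogeneous_mul {n : ℕ} {p : MvPolynomial (Fin n) K} {a : ℕ}
    (hp : p.IsHomogeneous a) (q : MvPolynomial (Fin n) K) (b : ℕ) :
    homogeneousComponent b (p * q) = if a ≤ b then p * homogeneousComponent (b - a) q else 0 := by
  conv_lhs => rw [← sum_homogeneousComponent q, Finset.mul_sum, map_sum]
  have h : ∀ c, homogeneousComponent b (p * homogeneousComponent c q) =
      if b = a + c then p * homogeneousComponent c q else 0 := fun c =>
    homogeneousComponent_of_mem (hp.mul (homogeneousComponent_isHomogeneous c q))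
  simp_rw [h]
  split_ifs with hab
  · rw [Finset.sum_eq_single (b - a)]
    · rw [if_pos (by omega)]
    · intro c _ hc
      rw [if_neg (by omega)]
    · intro hc
      rw [Finset.mem_range, not_lt] at hc
      rw [homogeneousComponent_eq_zero _ _ (by omega), mul_zero, ite_self]
  · exact Finset.sum_eq_zero fun c _ => if_neg (by omega)

theorem homogeneousComponent_mul {n : ℕ} (p q : MvPolynomial (Fin n) K) (d : ℕ) :
    homogeneousComponent d (p * q) =
      ∑ a ∈ Finset.range (d + 1), homogeneousComponent a p * homogeneousComponent (d - a) q := by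
  conv_lhs => rw [← sum_homogeneousComponent p, Finset.sum_mul, map_sum]
  simp_rw [fun a => homogeneousComponent_of_isHomogeneous_mul
    (homogeneousComponent_isHomogeneous a p) q d]
  rw [← Finset.sum_filter]
  refine Finset.sum_subset_zero_on_sdiff ?_ ?_ fun _ _ => rfl
  · intro a ha
    rw [Finset.mem_filter] at ha
    exact Finset.mem_range.2 (by omega)
  · intro a ha
    rw [Finset.mem_sdiff, Finset.mem_filter, Finset.mem_range, Finset.mem_range] at ha
    rw [homogeneousComponent_eq_zero a p (by omega), zero_mul]

theorem totalDegree_le_of_homogeneousComponent_eq_zero {n : ℕ} {p : MvPolynomial (Fin n) K} {s : ℕ}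
    (hp : p.totalDegree ≤ s + 1) (h : homogeneousComponent (s + 1) p = 0) :
    p.totalDegree ≤ s := by
  refine Finset.sup_le fun v hv => ?_
  have h1 := le_totalDegree hv
  by_contra hlt
  have h2 : v.degree = s + 1 := by
    change ¬ v.degree ≤ s at hlt
    change v.degree ≤ _ at h1
    omega
  have h3 : coeff v (homogeneousComponent (s + 1) p) = coeff v p := by
    rw [coeff_homogeneousComponent, if_pos h2]
  rw [h, coeff_zero] at h3
  exact (mem_support_iff.1 hv) h3.symm

theorem homogeneousComponent_homogeneousComponent {n : ℕ} (p : MvPolynomial (Fin n) K) (a b : ℕ) :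
    homogeneousComponent a (homogeneousComponent b p) =
      if a = b then homogeneousComponent b p else 0 :=
  homogeneousComponent_of_mem (homogeneousComponent_mem b p)

/-- The ideal of initial forms of `I`: a polynomial belongs to it if each of its homogeneous
components, say of degree `d`, is the component of degree `d` of an element of `I` of degree at
most `d`. Its zero set is the cone over the points of `V(I)` at infinity. -/
def Ideal.initialForms {n : ℕ} (I : Ideal (MvPolynomial (Fin n) K)) :
    Ideal (MvPolynomial (Fin n) K) where
  carrier := {p | ∀ d, ∃ f ∈ I, f.totalDegree ≤ d ∧
    homogeneousComponent d f = homogeneousComponent d p}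
  zero_mem' := fun d => ⟨0, I.zero_mem, by simp, rfl⟩
  add_mem' := by
    intro p q hp hq d
    obtain ⟨f, hf, hfd, hfp⟩ := hp d
    obtain ⟨g, hg, hgd, hgq⟩ := hq d
    exact ⟨f + g, I.add_mem hf hg, (totalDegree_add _ _).trans (max_le hfd hgd), by
      rw [map_add, map_add, hfp, hgq]⟩
  smul_mem' := by
    intro q p hp d
    choose f hf hfd hfp using hp
    refine ⟨∑ a ∈ Finset.range (d + 1), homogeneousComponent a q * f (d - a),
      I.sum_mem fun a _ => I.mul_mem_left _ (hf _), totalDegree_finsetSum_le fun a ha => ?_, ?_⟩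
    · have := Finset.mem_range.1 ha
      have h1 := (homogeneousComponent_isHomogeneous a q).totalDegree_le
      have h2 := hfd (d - a)
      exact (totalDegree_mul _ _).trans (by omega)
    · rw [map_sum, smul_eq_mul, homogeneousComponent_mul]
      refine Finset.sum_congr rfl fun a ha => ?_
      rw [homogeneousComponent_of_isHomogeneous_mul (homogeneousComponent_isHomogeneous a q),
        if_pos (Nat.lt_succ_iff.1 (Finset.mem_range.1 ha)), hfp]

theorem homogeneousComponent_mem_initialForms {n : ℕ} {I : Ideal (MvPolynomial (Fin n) K)}
    {f : MvPolynomial (Fin n) K} (hf : f ∈ I) {d : ℕ} (hd : f.totalDegree ≤ d) :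
    homogeneousComponent d f ∈ I.initialForms := by
  intro e
  by_cases h : e = d
  · subst h
    exact ⟨f, hf, hd, by rw [homogeneousComponent_homogeneousComponent, if_pos rfl]⟩
  · exact ⟨0, I.zero_mem, by simp, by
      rw [homogeneousComponent_homogeneousComponent, if_neg h, map_zero]⟩

theorem homogeneousComponent_mem_initialForms_of_mem {n : ℕ} {I : Ideal (MvPolynomial (Fin n) K)}
    {p : MvPolynomial (Fin n) K} (hp : p ∈ I.initialForms) (d : ℕ) :
    homogeneousComponent d p ∈ I.initialForms := by
  obtain ⟨f, hf, hfd, hfp⟩ := hp d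
  rw [← hfp]
  exact homogeneousComponent_mem_initialForms hf hfd

theorem finrank_map_add_finrank_ker_inf {M N : Type*} [AddCommGroup M] [Module K M]
    [AddCommGroup N] [Module K N] (f : M →ₗ[K] N) (p : Submodule K M) [FiniteDimensional K p] :
    Module.finrank K (p.map f) + Module.finrank K (LinearMap.ker f ⊓ p : Submodule K M) =
      Module.finrank K p := by
  have h : LinearMap.ker f ⊓ p = (LinearMap.ker (f.domRestrict p)).map p.subtype := by
    ext x
    simp [and_comm]
  rw [← LinearMap.finrank_range_add_finrank_ker (f.domRestrict p), LinearMap.range_domRestrict, h,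
    ← LinearEquiv.finrank_eq (Submodule.equivMapOfInjective p.subtype p.injective_subtype
    (LinearMap.ker (f.domRestrict p)))]

/-- Induction on `s`: the part of degree exactly `s + 1` of an element of `I` of degree at most
`s + 1` is an initial form, and it vanishes only if the degree is at most `s`. -/
theorem finrank_inf_restrictTotalDegree_le {n : ℕ} (I : Ideal (MvPolynomial (Fin n) K)) (s : ℕ) :
    Module.finrank K (I.restrictScalars K ⊓ restrictTotalDegree (Fin n) K s : Submodule K _) ≤
      Module.finrank K
        (I.initialForms.restrictScalars K ⊓ restrictTotalDegree (Fin n) K s : Submodule K _) := by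
  have hfin : ∀ (J : Ideal (MvPolynomial (Fin n) K)) (t : ℕ), FiniteDimensional K
      (J.restrictScalars K ⊓ restrictTotalDegree (Fin n) K t : Submodule K _) :=
    fun J t => Submodule.finiteDimensional_inf_right _ _
  induction s with
  | zero =>
    refine Submodule.finrank_mono ?_
    rintro f ⟨hf, hf0⟩
    refine ⟨?_, hf0⟩
    rw [SetLike.mem_coe, mem_restrictTotalDegree] at hf0
    have h := homogeneousComponent_mem_initialForms hf hf0
    rwa [homogeneousComponent_eq_self] at h
    rw [← totalDegree_zero_iff_isHomogeneous]
    omega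
  | succ s ih =>
    have h1 := finrank_map_add_finrank_ker_inf (homogeneousComponent (s + 1))
      (I.restrictScalars K ⊓ restrictTotalDegree (Fin n) K (s + 1) : Submodule K _)
    have h2 := finrank_map_add_finrank_ker_inf (homogeneousComponent (s + 1))
      (I.initialForms.restrictScalars K ⊓ restrictTotalDegree (Fin n) K (s + 1) : Submodule K _)
    have h3 : Module.finrank K (LinearMap.ker (homogeneousComponent (s + 1)) ⊓
        (I.restrictScalars K ⊓ restrictTotalDegree (Fin n) K (s + 1)) : Submodule K _) ≤
        Module.finrank K
          (I.restrictScalars K ⊓ restrictTotalDegree (Fin n) K s : Submodule K _) := by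
      refine Submodule.finrank_mono ?_
      rintro f ⟨hf0, hf, hfs⟩
      rw [SetLike.mem_coe, mem_restrictTotalDegree] at hfs
      exact ⟨hf, (mem_restrictTotalDegree _ _ _).2
        (totalDegree_le_of_homogeneousComponent_eq_zero hfs hf0)⟩
    have h4 : Module.finrank K
        (I.initialForms.restrictScalars K ⊓ restrictTotalDegree (Fin n) K s : Submodule K _) ≤
        Module.finrank K (LinearMap.ker (homogeneousComponent (s + 1)) ⊓
        (I.initialForms.restrictScalars K ⊓ restrictTotalDegree (Fin n) K (s + 1)) :
          Submodule K _) := by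
      refine Submodule.finrank_mono ?_
      rintro f ⟨hf, hfs⟩
      rw [SetLike.mem_coe, mem_restrictTotalDegree] at hfs
      exact ⟨homogeneousComponent_eq_zero _ _ (by omega), hf,
        (mem_restrictTotalDegree _ _ _).2 (by omega)⟩
    have h5 : Module.finrank K ((I.restrictScalars K ⊓ restrictTotalDegree (Fin n) K (s + 1) :
        Submodule K _).map (homogeneousComponent (s + 1))) ≤
        Module.finrank K ((I.initialForms.restrictScalars K ⊓
          restrictTotalDegree (Fin n) K (s + 1) :
        Submodule K _).map (homogeneousComponent (s + 1))) := by
      refine Submodule.finrank_mono ?_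
      rintro _ ⟨f, ⟨hf, hfs⟩, rfl⟩
      rw [SetLike.mem_coe, mem_restrictTotalDegree] at hfs
      refine ⟨homogeneousComponent (s + 1) f,
        ⟨homogeneousComponent_mem_initialForms hf hfs, ?_⟩, ?_⟩
      · rw [SetLike.mem_coe, mem_restrictTotalDegree]
        exact (homogeneousComponent_isHomogeneous _ _).totalDegree_le
      · rw [homogeneousComponent_homogeneousComponent, if_pos rfl]
    omega

/-- The leading forms of `I` in degrees up to `s` span a space at least as large as the part of `I`
of degree at most `s`, so the quotient by the initial forms is not larger. -/
theorem hilbertFn_initialForms_le {n : ℕ} (I : Ideal (MvPolynomial (Fin n) K)) (s : ℕ) :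
    I.initialForms.hilbertFn s ≤ I.hilbertFn s := by
  have hker : ∀ J : Ideal (MvPolynomial (Fin n) K),
      LinearMap.ker (Ideal.Quotient.mkₐ K J).toLinearMap = J.restrictScalars K := by
    intro J
    ext f
    exact Ideal.Quotient.eq_zero_iff_mem
  have h1 := finrank_map_add_finrank_ker_inf (Ideal.Quotient.mkₐ K I).toLinearMap
    (restrictTotalDegree (Fin n) K s)
  have h2 := finrank_map_add_finrank_ker_inf (Ideal.Quotient.mkₐ K I.initialForms).toLinearMap
    (restrictTotalDegree (Fin n) K s)
  rw [hker] at h1 h2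
  have h3 := finrank_inf_restrictTotalDegree_le I s
  unfold Ideal.hilbertFn
  omega

/-- The Hilbert function of a prime of dimension `e` over the initial ideal grows at least like
`s ^ e`, and it is bounded by the Hilbert function of `I`, which grows at most like `s ^ d`. -/
theorem ringKrullDim_quotient_initialForms_le {n d : ℕ} (I : Ideal (MvPolynomial (Fin n) K))
    (hd : ringKrullDim (MvPolynomial (Fin n) K ⧸ I) = d) :
    ringKrullDim (MvPolynomial (Fin n) K ⧸ I.initialForms) ≤ d := by
  refine ringKrullDim_quotient_le_of_forall_isPrime fun Q hQ hIQ => ?_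
  rcases eq_bot_or_eq_natCast_of_le_natCast
    ((ringKrullDim_quotient_le Q).trans (ringKrullDim_mvPolynomial_fin n).le) with h | ⟨e, -, he⟩
  · rw [h]; exact bot_le
  rw [he]
  by_contra hlt
  have hde : d + 1 ≤ e := by
    by_contra h
    exact hlt (by exact_mod_cast (by omega : e ≤ d))
  obtain ⟨C, hC⟩ := exists_hilbertFn_le I hd
  -- at `s = M` the two bounds on the Hilbert function of `Q` contradict `d + 1 ≤ e`
  set M := e.factorial * C with hM
  have h1 : (M + 1) ^ (d + 1) ≤ M * (M + 1) ^ d := by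
    calc (M + 1) ^ (d + 1) ≤ (M + 1) ^ e := Nat.pow_le_pow_right (by omega) hde
      _ ≤ e.factorial * Q.hilbertFn M := pow_le_factorial_mul_hilbertFn Q he M
      _ ≤ e.factorial * (C * (M + 1) ^ d) := Nat.mul_le_mul_left _
          ((hilbertFn_anti hIQ M).trans ((hilbertFn_initialForms_le I M).trans (hC M)))
      _ = M * (M + 1) ^ d := by rw [hM, mul_assoc]
  rw [pow_succ, mul_comm] at h1
  have := Nat.le_of_mul_le_mul_right h1 (by positivity)
  omega

/-- Cutting by an element outside the minimal primes of maximal dimension lowers the dimension. -/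
theorem ringKrullDim_quotient_sup_span_singleton_le {R : Type*} [CommRing R] {J : Ideal R} {x : R}
    {d : ℕ} (hJ : ringKrullDim (R ⧸ J) ≤ (d + 1 : ℕ))
    (hx : ∀ Q ∈ J.minimalPrimes, ringKrullDim (R ⧸ Q) = (d + 1 : ℕ) → x ∉ Q) :
    ringKrullDim (R ⧸ (J ⊔ Ideal.span {x})) ≤ d := by
  refine ringKrullDim_quotient_le_of_forall_isPrime fun Q' hQ' hJQ' => ?_
  rw [sup_le_iff, Ideal.span_singleton_le_iff_mem] at hJQ'
  obtain ⟨Q, hQ, hQQ'⟩ := Ideal.exists_minimalPrimes_le hJQ'.1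
  have := hQ.1.1
  have hQd := (ringKrullDim_quotient_anti hQ.1.2).trans hJ
  by_cases h : ringKrullDim (R ⧸ Q) = (d + 1 : ℕ)
  · have hlt : Q < Q' := lt_of_le_of_ne hQQ' fun he => hx Q hQ h (he ▸ hJQ'.2)
    have h1 := ringKrullDim_quotient_add_one_le_of_lt hlt
    rw [h] at h1
    rcases eq_bot_or_eq_natCast_of_le_natCast
      ((ringKrullDim_quotient_anti hQQ').trans hQd) with h2 | ⟨e, -, he⟩
    · rw [h2]; exact bot_le
    · rw [he] at h1 ⊢
      have : e + 1 ≤ d + 1 := by exact_mod_cast h1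
      exact_mod_cast (by omega : e ≤ d)
  · refine (ringKrullDim_quotient_anti hQQ').trans ?_
    rcases eq_bot_or_eq_natCast_of_le_natCast hQd with h2 | ⟨e, hed, he⟩
    · rw [h2]; exact bot_le
    · rw [he] at h ⊢
      have : e ≠ d + 1 := fun h' => h (by rw [h'])
      exact_mod_cast (by omega : e ≤ d)

/-! ### Linear forms and homogeneous ideals -/

/-- The linear form `c₁ x₁ + ⋯ + cₙ xₙ`, as a linear function of its coefficients. -/
noncomputable def linearForm (n : ℕ) : (Fin n → K) →ₗ[K] MvPolynomial (Fin n) K :=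
  Fintype.linearCombination K X

theorem linearForm_apply {n : ℕ} (c : Fin n → K) :
    linearForm n c = ∑ i, C (c i) * X i := by
  simp [linearForm, Fintype.linearCombination_apply, smul_eq_C_mul]

theorem linearForm_isHomogeneous {n : ℕ} (c : Fin n → K) : (linearForm n c).IsHomogeneous 1 := by
  rw [linearForm_apply]
  exact IsHomogeneous.sum _ _ _ fun i _ => isHomogeneous_C_mul_X _ _

theorem linearForm_single {n : ℕ} (i : Fin n) :
    linearForm n (Pi.single i 1) = (X i : MvPolynomial (Fin n) K) := by
  simp [linearForm]

/-- Prime avoidance by linear forms, over an infinite field. -/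
theorem exists_linearForm_notMem [Infinite K] {n : ℕ}
    (F : Finset (Ideal (MvPolynomial (Fin n) K)))
    (hF : ∀ Q ∈ F, ∃ i, (X i : MvPolynomial (Fin n) K) ∉ Q) :
    ∃ c : Fin n → K, ∀ Q ∈ F, linearForm n c ∉ Q := by
  classical
  let s : Finset (Subspace K (Fin n → K)) :=
    F.image fun Q => (Q.restrictScalars K).comap (linearForm n)
  have hs : ⊤ ∉ s := by
    intro h
    obtain ⟨Q, hQ, hQt⟩ := Finset.mem_image.1 h
    obtain ⟨i, hi⟩ := hF Q hQ
    apply hi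
    have : Pi.single i (1 : K) ∈ (Q.restrictScalars K).comap (linearForm n) := by
      rw [hQt]; trivial
    rw [← linearForm_single]
    exact this
  have h := Subspace.biUnion_ne_univ_of_top_notMem hs
  obtain ⟨c, hc⟩ := (Set.ne_univ_iff_exists_notMem _).1 h
  refine ⟨c, fun Q hQ hcQ => hc ?_⟩
  exact Set.mem_biUnion (Finset.mem_image_of_mem _ hQ) hcQ

theorem exists_X_notMem_of_ringKrullDim_pos {n : ℕ} {Q : Ideal (MvPolynomial (Fin n) K)}
    [Q.IsPrime] {d : ℕ} (hQ : ringKrullDim (MvPolynomial (Fin n) K ⧸ Q) = (d + 1 : ℕ)) :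
    ∃ i, (X i : MvPolynomial (Fin n) K) ∉ Q := by
  obtain ⟨t, ht⟩ := exists_algebraicIndependent_X Q hQ
  refine ⟨t 0, fun h => ht.ne_zero 0 ?_⟩
  exact Ideal.Quotient.eq_zero_iff_mem.2 h

attribute [local instance] MvPolynomial.gradedAlgebra

/-- The homogeneous core of a prime ideal containing `J` is a prime between `J` and the irrelevant
ideal; since `J` has dimension zero, it is the irrelevant ideal. -/
theorem X_mem_radical_of_ringKrullDim_le_zero {n : ℕ} {J : Ideal (MvPolynomial (Fin n) K)}
    (hJ : J.IsHomogeneous (homogeneousSubmodule (Fin n) K))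
    (hd : ringKrullDim (MvPolynomial (Fin n) K ⧸ J) ≤ 0) (i : Fin n) : X i ∈ J.radical := by
  rw [Ideal.radical_eq_sInf, Submodule.mem_sInf]
  rintro Q ⟨hJQ, hQ⟩
  set Q₀ := (Ideal.homogeneousCore (homogeneousSubmodule (Fin n) K) Q).toIdeal with hQ₀
  have hprime : Q₀.IsPrime := Ideal.IsPrime.homogeneousCore hQ
  have hJQ₀ : J ≤ Q₀ := by
    rw [← hJ.toIdeal_homogeneousCore_eq_self]
    exact Ideal.homogeneousCore_mono _ hJQ
  suffices X i ∈ Q₀ from Ideal.toIdeal_homogeneousCore_le (homogeneousSubmodule (Fin n) K) Q this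
  let m : Ideal (MvPolynomial (Fin n) K) := RingHom.ker (constantCoeff (R := K))
  have hm : m ≠ ⊤ := RingHom.ker_ne_top _
  have hle : Q₀ ≤ m := by
    intro p hp
    have h0 := homogeneousComponent_mem_of_mem
      (Ideal.homogeneousCore (homogeneousSubmodule (Fin n) K) Q).isHomogeneous hp 0
    rw [homogeneousComponent_zero] at h0
    by_contra hne
    have hne : coeff 0 p ≠ 0 := hne
    exact hprime.ne_top (Ideal.eq_top_of_isUnit_mem _ h0 (hne.isUnit.map C))
  by_contra hi
  have hlt : Q₀ < m := lt_of_le_of_ne hle fun h => hi (by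
    rw [h]; simp [m, RingHom.mem_ker])
  have h1 := (ringKrullDim_quotient_add_one_le_of_lt hlt).trans
    ((ringKrullDim_quotient_anti hJQ₀).trans hd)
  have := Ideal.Quotient.nontrivial_iff.2 hm
  have h2 : (0 : WithBot ℕ∞) ≤ ringKrullDim (MvPolynomial (Fin n) K ⧸ m) :=
    ringKrullDim_nonneg_of_nontrivial
  have h3 : (0 : WithBot ℕ∞) + 1 ≤ 0 := (add_le_add_left h2 1).trans h1
  have h4 : (0 : ℕ) + 1 ≤ 0 := by exact_mod_cast h3
  omega

theorem isHomogeneous_sup_span_linearForm {n : ℕ} {J : Ideal (MvPolynomial (Fin n) K)}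
    (hJ : J.IsHomogeneous (homogeneousSubmodule (Fin n) K)) (c : Fin n → K) :
    (J ⊔ Ideal.span {linearForm n c}).IsHomogeneous (homogeneousSubmodule (Fin n) K) := by
  refine hJ.sup (Ideal.homogeneous_span _ _ ?_)
  rintro x rfl
  exact ⟨1, linearForm_isHomogeneous c⟩

theorem isHomogeneous_initialForms {n : ℕ} (I : Ideal (MvPolynomial (Fin n) K)) :
    I.initialForms.IsHomogeneous (homogeneousSubmodule (Fin n) K) := by
  intro i p hp
  have := homogeneousComponent_mem_initialForms_of_mem hp i
  rw [← decomposition.decompose'_apply] at this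
  exact this

theorem sup_span_singleton_sup_span_range {n d : ℕ} (J : Ideal (MvPolynomial (Fin n) K))
    (c : Fin n → K) (y : Fin d → Fin n → K) :
    J ⊔ Ideal.span {linearForm n c} ⊔ Ideal.span (Set.range fun j => linearForm n (y j)) =
      J ⊔ Ideal.span (Set.range fun j =>
        linearForm n ((Fin.cons c y : Fin (d + 1) → Fin n → K) j)) := by
  rw [sup_assoc, ← Ideal.span_union, Set.singleton_union, ← Fin.range_cons]
  congr 3
  funext j
  refine Fin.cases ?_ (fun j => ?_) j <;> simp

/-- A homogeneous ideal of dimension at most `d` has a linear system of parameters. -/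
theorem exists_linearForms_X_mem_radical [Infinite K] {n : ℕ} (d : ℕ)
    {J : Ideal (MvPolynomial (Fin n) K)}
    (hJ : J.IsHomogeneous (homogeneousSubmodule (Fin n) K))
    (hd : ringKrullDim (MvPolynomial (Fin n) K ⧸ J) ≤ d) :
    ∃ y : Fin d → Fin n → K, ∀ i,
      X i ∈ (J ⊔ Ideal.span (Set.range fun j => linearForm n (y j))).radical := by
  induction d generalizing J with
  | zero =>
    refine ⟨Fin.elim0, fun i => ?_⟩
    exact Ideal.radical_mono le_sup_left (X_mem_radical_of_ringKrullDim_le_zero hJ hd i)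
  | succ d ih =>
    classical
    let F := (J.finite_minimalPrimes_of_isNoetherianRing).toFinset.filter fun Q =>
      ringKrullDim (MvPolynomial (Fin n) K ⧸ Q) = (d + 1 : ℕ)
    obtain ⟨c, hc⟩ := exists_linearForm_notMem F (by
      intro Q hQ
      rw [Finset.mem_filter, Set.Finite.mem_toFinset] at hQ
      have := hQ.1.1.1
      exact exists_X_notMem_of_ringKrullDim_pos hQ.2)
    obtain ⟨y, hy⟩ := ih (isHomogeneous_sup_span_linearForm hJ c)
      (ringKrullDim_quotient_sup_span_singleton_le hd fun Q hQ hQd =>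
        hc Q (Finset.mem_filter.2 ⟨(Set.Finite.mem_toFinset _).2 hQ, hQd⟩))
    refine ⟨Fin.cons c y, fun i => ?_⟩
    rw [← sup_span_singleton_sup_span_range]
    exact hy i

/-! ### Noether normalization by linear forms -/

/-- If the linear forms `y_j` together with the initial forms of `I` generate an ideal with
radical containing the variables, then every monomial of large degree is congruent modulo `I` to
a combination of the `y_j` plus terms of lower degree. Hence the monomials of small degree
generate the quotient by `I` as a module over the polynomials in the `y_j`. -/
theorem finite_of_X_mem_radical {n d : ℕ} {B : Type*} [CommRing B] [Algebra K B]
    [Algebra (MvPolynomial (Fin d) K) B] [IsScalarTower K (MvPolynomial (Fin d) K) B]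
    (π : MvPolynomial (Fin n) K →ₐ[K] B) (hπ : Function.Surjective π)
    {I : Ideal (MvPolynomial (Fin n) K)} (hI : ∀ f ∈ I, π f = 0) (y : Fin d → Fin n → K)
    (hy : ∀ j, algebraMap (MvPolynomial (Fin d) K) B (X j) = π (linearForm n (y j)))
    (hX : ∀ i, X i ∈
      (I.initialForms ⊔ Ideal.span (Set.range fun j => linearForm n (y j))).radical) :
    Module.Finite (MvPolynomial (Fin d) K) B := by
  choose N hN using hX
  let M := ∑ i, N i
  have hfin : {v : Fin n →₀ ℕ | v.degree ≤ M}.Finite := Finsupp.finite_of_degree_le M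
  let T : Submodule (MvPolynomial (Fin d) K) B :=
    Submodule.span _ ((fun v => π (monomial v 1)) '' {v : Fin n →₀ ℕ | v.degree ≤ M})
  have hsmul : ∀ (c : K) (b : B), b ∈ T → c • b ∈ T := fun c b hb => by
    rw [← algebraMap_smul (MvPolynomial (Fin d) K) c b]
    exact T.smul_mem _ hb
  have hsum : ∀ p : MvPolynomial (Fin n) K, (∀ v ∈ p.support, π (monomial v 1) ∈ T) → π p ∈ T := by
    intro p hp
    rw [p.as_sum, map_sum]
    refine Submodule.sum_mem _ fun v hv => ?_
    rw [← mul_one (coeff v p), ← smul_eq_mul, ← smul_monomial, map_smul]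
    exact hsmul _ _ (hp v hv)
  have hT : ∀ (t : ℕ) (p : MvPolynomial (Fin n) K), p.totalDegree ≤ t → π p ∈ T := by
    intro t
    induction t with
    | zero =>
      intro p hp
      refine hsum p fun v hv => Submodule.subset_span ⟨v, ?_, rfl⟩
      exact ((le_totalDegree hv).trans hp).trans (Nat.zero_le _)
    | succ t ih =>
      intro p hp
      refine hsum p fun v hv => ?_
      by_cases hvM : v.degree ≤ M
      · exact Submodule.subset_span ⟨v, hvM, rfl⟩
      have hvt : v.degree ≤ t + 1 := (le_totalDegree hv).trans hp
      rcases Nat.lt_or_ge v.degree (t + 1) with hlt | hge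
      · refine ih _ ?_
        rw [totalDegree_monomial _ one_ne_zero]
        exact Nat.lt_succ_iff.1 hlt
      have hvt : v.degree = t + 1 := le_antisymm hvt hge
      -- a monomial of degree larger than `M = ∑ N_i` is divisible by some `x_i ^ N_i`
      obtain ⟨i, hi⟩ : ∃ i, N i ≤ v i := by
        by_contra! h
        apply hvM
        rw [Finsupp.degree_eq_sum]
        exact Finset.sum_le_sum fun i _ => (h i).le
      have hmem : (monomial v 1 : MvPolynomial (Fin n) K) ∈
          I.initialForms ⊔ Ideal.span (Set.range fun j => linearForm n (y j)) := by
        have hv' : v = Finsupp.single i (N i) + (v - Finsupp.single i (N i)) :=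
          (add_tsub_cancel_of_le (Finsupp.single_le_iff.2 hi)).symm
        have : (monomial v 1 : MvPolynomial (Fin n) K) =
            X i ^ N i * monomial (v - Finsupp.single i (N i)) 1 := by
          rw [X_pow_eq_monomial, monomial_mul, one_mul, ← hv']
        rw [this]
        exact Ideal.mul_mem_right _ _ (hN i)
      obtain ⟨g, hg, l, hl, hgl⟩ := Submodule.mem_sup.1 hmem
      obtain ⟨a, rfl⟩ := (Ideal.mem_span_range_iff_exists_fun).1 hl
      obtain ⟨f, hf, hft, hfg⟩ := hg (t + 1)
      have hcomp := congrArg (homogeneousComponent (t + 1)) hgl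
      have hvhom : (monomial v (1 : K)).IsHomogeneous (t + 1) := isHomogeneous_monomial 1 hvt
      have ha : ∀ j, homogeneousComponent (t + 1) (a j * linearForm n (y j)) =
          linearForm n (y j) * homogeneousComponent t (a j) := fun j => by
        rw [mul_comm, homogeneousComponent_of_isHomogeneous_mul (linearForm_isHomogeneous _),
          if_pos (by omega), Nat.add_sub_cancel]
      rw [map_add, map_sum, ← hfg, homogeneousComponent_eq_self hvhom] at hcomp
      simp_rw [ha] at hcomp
      set q := ∑ j, linearForm n (y j) * homogeneousComponent t (a j) with hq
      have hqhom : q.IsHomogeneous (t + 1) := IsHomogeneous.sum _ _ _ fun j _ => by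
        have := (linearForm_isHomogeneous (y j)).mul (homogeneousComponent_isHomogeneous t (a j))
        rwa [add_comm] at this
      -- `f ∈ I` has the initial form that cancels the top degree of `monomial v 1 - q`
      have hrest : (monomial v 1 - f - q).totalDegree ≤ t := by
        refine totalDegree_le_of_homogeneousComponent_eq_zero ?_ ?_
        · refine (totalDegree_sub _ _).trans (max_le ((totalDegree_sub _ _).trans
            (max_le hvhom.totalDegree_le hft)) hqhom.totalDegree_le)
        · rw [map_sub, map_sub, homogeneousComponent_eq_self hvhom,
            homogeneousComponent_eq_self hqhom, ← hcomp]
          ring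
      have hπv : π (monomial v 1) = π (monomial v 1 - f - q) +
          ∑ j, (X j : MvPolynomial (Fin d) K) • π (homogeneousComponent t (a j)) := by
        simp_rw [Algebra.smul_def, hy, ← map_mul, ← map_sum, ← hq, map_sub, hI f hf]
        ring
      rw [hπv]
      refine T.add_mem (ih _ hrest) (T.sum_mem fun j _ => T.smul_mem _ (ih _ ?_))
      exact (homogeneousComponent_isHomogeneous _ _).totalDegree_le
  refine ⟨⟨(hfin.image fun v => π (monomial v 1)).toFinset, ?_⟩⟩
  rw [Set.Finite.coe_toFinset, eq_top_iff]
  intro b _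
  obtain ⟨p, rfl⟩ := hπ b
  exact hT _ p le_rfl

/-- A linear form that lies in no minimal prime of maximal dimension of the initial ideal cuts
down the dimension by exactly one, whatever constant is added to it. -/
theorem ringKrullDim_quotient_sup_span_linearForm_add_C [Infinite K] {n d : ℕ}
    {I : Ideal (MvPolynomial (Fin n) K)}
    (hI : ringKrullDim (MvPolynomial (Fin n) K ⧸ I) = (d + 1 : ℕ)) {c : Fin n → K}
    (hc : ∀ Q ∈ I.initialForms.minimalPrimes,
      ringKrullDim (MvPolynomial (Fin n) K ⧸ Q) = (d + 1 : ℕ) → linearForm n c ∉ Q) (a : K) :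
    ringKrullDim (MvPolynomial (Fin n) K ⧸ (I ⊔ Ideal.span {linearForm n c + C a})) = d := by
  have h1 := ringKrullDim_quotient_sup_span_singleton_le
    (ringKrullDim_quotient_initialForms_le I hI) hc
  obtain ⟨y, hy⟩ := exists_linearForms_X_mem_radical d
    (isHomogeneous_sup_span_linearForm (isHomogeneous_initialForms I) c) h1
  let z : Fin (d + 1) → Fin n → K := Fin.cons c y
  have hz : ∀ i, X i ∈
      (I.initialForms ⊔ Ideal.span (Set.range fun j => linearForm n (z j))).radical := by
    intro i
    rw [← sup_span_singleton_sup_span_range]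
    exact hy i
  let φ : MvPolynomial (Fin (d + 1)) K →ₐ[K] MvPolynomial (Fin n) K ⧸ I :=
    aeval fun j => Ideal.Quotient.mkₐ K I (linearForm n (z j))
  have hφ : φ.toRingHom.IsIntegral := by
    algebraize [φ.toRingHom]
    have : IsScalarTower K (MvPolynomial (Fin (d + 1)) K) (MvPolynomial (Fin n) K ⧸ I) :=
      IsScalarTower.of_algHom φ
    have := finite_of_X_mem_radical (Ideal.Quotient.mkₐ K I) (Ideal.Quotient.mkₐ_surjective K I)
      (fun f hf => Ideal.Quotient.eq_zero_iff_mem.2 hf) z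
      (fun j => aeval_X (R := K) (fun j => Ideal.Quotient.mkₐ K I (linearForm n (z j))) j) hz
    exact algebraMap_isIntegral_iff.2 (Algebra.IsIntegral.of_finite _ _)
  have h2 := ringKrullDim_quotient_of_isIntegral φ.toRingHom hφ hI a
  have h3 : φ.toRingHom (X 0 + C a) = Ideal.Quotient.mk I (linearForm n c + C a) := by
    change φ (X 0 + C a) = _
    rw [map_add, map_add, aeval_X]
    congr 1
    exact φ.commutes a
  rw [h3] at h2
  have h4 : Ideal.span {Ideal.Quotient.mk I (linearForm n c + C a)} =
      (Ideal.span {linearForm n c + C a}).map (Ideal.Quotient.mk I) := by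
    rw [Ideal.map_span, Set.image_singleton]
  rw [← h2, h4]
  exact ringKrullDim_eq_of_ringEquiv (DoubleQuot.quotQuotEquivQuotSup I _).symm

end Field

/-! ### The number of top-dimensional components and the leading coefficient -/

/-- The upper bound on `u` keeps the upper limit from being that of an unbounded sequence, which
would be a junk value. -/
theorem card_le_limsup_of_hilbertFn_le {K : Type*} [Field K] {n δ C : ℕ}
    {J : Ideal (MvPolynomial (Fin n) K)}
    (F : Finset (Ideal (MvPolynomial (Fin n) K))) (hF : ∀ Q ∈ F, Q.IsPrime)
    (hJ : ∀ Q ∈ F, J ≤ Q) (hinc : ∀ Q ∈ F, ∀ Q' ∈ F, Q ≤ Q' → Q = Q')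
    (hdim : ∀ Q ∈ F, ringKrullDim (MvPolynomial (Fin n) K ⧸ Q) = δ)
    {u : ℕ → ℕ} (hJu : ∀ s, J.hilbertFn s ≤ u s) (hu : ∀ s, u s ≤ C * (s + 1) ^ δ) :
    (F.card : ℝ) ≤ Filter.limsup (fun s : ℕ => (δ.factorial : ℝ) * u s / (s : ℝ) ^ δ)
      Filter.atTop := by
  obtain ⟨c, hc⟩ := exists_sum_hilbertFn_le F hF hJ hinc
  have hlow : ∀ s, F.card * (s + 1) ^ δ ≤ δ.factorial * u (s + c) := by
    intro s
    calc F.card * (s + 1) ^ δ = ∑ Q ∈ F, (s + 1) ^ δ := by simp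
      _ ≤ ∑ Q ∈ F, δ.factorial * Q.hilbertFn s := Finset.sum_le_sum fun Q hQ => by
          have := hF Q hQ
          exact pow_le_factorial_mul_hilbertFn Q (hdim Q hQ) s
      _ = δ.factorial * ∑ Q ∈ F, Q.hilbertFn s := by rw [Finset.mul_sum]
      _ ≤ _ := Nat.mul_le_mul_left _ ((hc s).trans (hJu _))
  have htend : Filter.Tendsto (fun s : ℕ => (F.card : ℝ) * (1 - (c : ℝ) / s) ^ δ) Filter.atTop
      (nhds F.card) := by
    have h := ((tendsto_const_div_atTop_nhds_zero_nat (c : ℝ)).const_sub 1).pow δ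
    simpa using h.const_mul (F.card : ℝ)
  rw [← htend.limsup_eq]
  refine Filter.limsup_le_limsup ?_ htend.isCoboundedUnder_le ?_
  · filter_upwards [Filter.eventually_ge_atTop (c + 1)] with s hs
    have hs0 : (0 : ℝ) < s := by exact_mod_cast (by omega : 0 < s)
    have hcs : (c : ℝ) ≤ s := by exact_mod_cast (by omega : c ≤ s)
    rw [le_div_iff₀ (by positivity), mul_assoc, ← mul_pow]
    have h1 : (1 - (c : ℝ) / s) * s = ((s - c : ℕ) : ℝ) := by
      rw [Nat.cast_sub (by omega)]; field_simp
    have h2 := hlow (s - c)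
    rw [Nat.sub_add_cancel (by omega)] at h2
    have h3 : (F.card : ℝ) * ((s - c : ℕ) + 1 : ℝ) ^ δ ≤ δ.factorial * u s := by exact_mod_cast h2
    rw [h1]
    refine le_trans ?_ h3
    gcongr
    linarith
  · refine ⟨(δ.factorial : ℝ) * (C * 2 ^ δ), Filter.eventually_map.2 ?_⟩
    filter_upwards [Filter.eventually_ge_atTop 1] with s hs
    have hs1 : (1 : ℝ) ≤ s := by exact_mod_cast hs
    rw [div_le_iff₀ (by positivity), mul_assoc]
    have h1 : (u s : ℝ) ≤ C * (s + 1 : ℝ) ^ δ := by exact_mod_cast hu s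
    refine mul_le_mul_of_nonneg_left (h1.trans ?_) (by positivity)
    rw [mul_assoc, ← mul_pow]
    gcongr
    linarith

/-! ### Random points avoid proper subspaces -/

/-- If the basis vector `e_i` is not in `U`, then a vector of `U` is determined by its coordinates
other than the `i`-th one: overwriting that coordinate by an arbitrary element of `S` is
injective. -/
theorem card_filter_mem_mul_card_le {K ι : Type*} [Field K] [Fintype ι] [DecidableEq ι]
    (S : Finset K) {U : Submodule K (ι → K)} [DecidablePred (· ∈ U)] (hU : U ≠ ⊤) :
    ((Fintype.piFinset fun _ : ι => S).filter (· ∈ U)).card * S.card ≤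
      (Fintype.piFinset fun _ : ι => S).card := by
  obtain ⟨i, hi⟩ : ∃ i, Pi.single i (1 : K) ∉ U := by
    by_contra! h
    refine hU (eq_top_iff.2 fun c _ => ?_)
    rw [pi_eq_sum_univ' c]
    refine U.sum_mem fun i _ => U.smul_mem _ ?_
    exact h i
  rw [← Finset.card_product]
  refine Finset.card_le_card_of_injOn (fun p => Function.update p.1 i p.2) ?_ ?_
  · rintro ⟨c, a⟩ h
    simp only [Finset.coe_product, Set.mem_prod, Finset.mem_coe, Finset.mem_filter,
      Fintype.mem_piFinset] at h ⊢
    intro j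
    by_cases hj : j = i
    · subst hj; simpa using h.2
    · simpa [hj] using h.1.1 j
  · rintro ⟨c, a⟩ h ⟨c', a'⟩ h' heq
    simp only [Finset.coe_product, Set.mem_prod, Finset.mem_coe, Finset.mem_filter] at h h' heq
    have ha : a = a' := by simpa using congrFun heq i
    have hoff : ∀ j, j ≠ i → c j = c' j := fun j hj => by
      simpa [hj] using congrFun heq j
    have hsub : c - c' = (c i - c' i) • Pi.single i (1 : K) := by
      ext j
      by_cases hj : j = i
      · subst hj; simp
      · simp [hj, hoff j hj]
    have hmem := U.sub_mem h.1.2 h'.1.2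
    rw [hsub] at hmem
    have hii : c i = c' i := by
      by_contra hne
      exact hi ((U.smul_mem_iff (sub_ne_zero.2 hne)).1 hmem)
    rw [hii, sub_self, zero_smul, sub_eq_zero] at hsub
    rw [hsub, ha]

theorem card_filter_exists_mem_mul_card_le {K ι : Type*} [Field K] [Fintype ι] [DecidableEq ι]
    (S : Finset K) (F : Finset (Submodule K (ι → K))) (hF : ⊤ ∉ F)
    [DecidablePred fun c : ι → K => ∃ U ∈ F, c ∈ U] :
    ((Fintype.piFinset fun _ : ι => S).filter fun c => ∃ U ∈ F, c ∈ U).card * S.card ≤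
      F.card * (Fintype.piFinset fun _ : ι => S).card := by
  classical
  have hsub : ((Fintype.piFinset fun _ : ι => S).filter fun c => ∃ U ∈ F, c ∈ U) ⊆
      F.biUnion fun U => (Fintype.piFinset fun _ : ι => S).filter (· ∈ U) := by
    intro c hc
    obtain ⟨h1, U, hU, hcU⟩ := Finset.mem_filter.1 hc
    exact Finset.mem_biUnion.2 ⟨U, hU, Finset.mem_filter.2 ⟨h1, hcU⟩⟩
  calc _ ≤ (∑ U ∈ F, ((Fintype.piFinset fun _ : ι => S).filter (· ∈ U)).card) * S.card :=
        Nat.mul_le_mul_right _ ((Finset.card_le_card hsub).trans Finset.card_biUnion_le)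
    _ = ∑ U ∈ F, ((Fintype.piFinset fun _ : ι => S).filter (· ∈ U)).card * S.card :=
        Finset.sum_mul _ _ _
    _ ≤ ∑ U ∈ F, (Fintype.piFinset fun _ : ι => S).card := Finset.sum_le_sum fun U hU =>
        card_filter_mem_mul_card_le S fun h => hF (h ▸ hU)
    _ = _ := by simp

theorem randomCoeffs_eq_uniformOn (n : ℕ) (S : Finset ℂ) :
    randomCoeffs n S = ProbabilityTheory.uniformOn
      ((Fintype.piFinset fun _ : Fin (n + 1) => S : Finset (Fin (n + 1) → ℂ)) :
        Set (Fin (n + 1) → ℂ)) := by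
  classical
  refine MeasureTheory.Measure.pi_eq fun t _ => ?_
  have h1 : ∀ i, ProbabilityTheory.uniformOn (S : Set ℂ) (t i) =
      ((S.filter (· ∈ t i)).card : ENNReal) / S.card := by
    intro i
    rw [← ProbabilityTheory.uniformOn_inter_self S.finite_toSet,
      show (S : Set ℂ) ∩ t i = (S.filter (· ∈ t i) : Finset ℂ) by ext; simp,
      ProbabilityTheory.uniformOn_apply_finset,
      Finset.inter_eq_right.2 (Finset.filter_subset _ _)]
  have h2 : ((Fintype.piFinset fun _ : Fin (n + 1) => S : Finset _) : Set (Fin (n + 1) → ℂ)) ∩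
      Set.univ.pi t = (Fintype.piFinset fun i => S.filter (· ∈ t i) : Finset _) := by
    ext c
    simp [forall_and]
  rw [← ProbabilityTheory.uniformOn_inter_self (Finset.finite_toSet _), h2,
    ProbabilityTheory.uniformOn_apply_finset, Finset.inter_eq_right.2
      (Fintype.piFinset_subset _ _ fun i => Finset.filter_subset _ _)]
  simp_rw [h1]
  rw [ENNReal.prod_div_distrib_of_ne_top (by simp)]
  simp

theorem one_sub_card_div_card_le_randomCoeffs {n : ℕ} {S : Finset ℂ} (hS : S.Nonempty)
    (F : Finset (Submodule ℂ (Fin (n + 1) → ℂ))) (hF : ⊤ ∉ F) {G : Set (Fin (n + 1) → ℂ)}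
    (hG : ∀ c, (∀ U ∈ F, c ∉ U) → c ∈ G) :
    1 - (F.card : ℝ) / S.card ≤ (randomCoeffs n S).real G := by
  classical
  set T := Fintype.piFinset fun _ : Fin (n + 1) => S with hT
  have hTne : T.Nonempty := Fintype.piFinset_nonempty.2 fun _ => hS
  rw [randomCoeffs_eq_uniformOn]
  have := ProbabilityTheory.isProbabilityMeasure_uniformOn T.finite_toSet hTne
  set B := T.filter fun c => ∃ U ∈ F, c ∈ U with hB
  have hcount := card_filter_exists_mem_mul_card_le S F hF
  have hsub : ((T \ B : Finset _) : Set (Fin (n + 1) → ℂ)) ⊆ G := by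
    intro c hc
    rw [Finset.mem_coe, Finset.mem_sdiff, hB, Finset.mem_filter] at hc
    exact hG c fun U hU hcU => hc.2 ⟨hc.1, U, hU, hcU⟩
  refine le_trans ?_ (MeasureTheory.measureReal_mono hsub)
  have hBT : B ⊆ T := Finset.filter_subset _ _
  rw [MeasureTheory.measureReal_def, ProbabilityTheory.uniformOn_apply_finset,
    Finset.inter_eq_right.2 Finset.sdiff_subset, Finset.card_sdiff_of_subset hBT,
    ENNReal.toReal_div, ENNReal.toReal_natCast, ENNReal.toReal_natCast,
    Nat.cast_sub (Finset.card_le_card hBT), sub_div, div_self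
      (Nat.cast_ne_zero.2 hTne.card_ne_zero)]
  have hSpos : (0 : ℝ) < S.card := Nat.cast_pos.2 hS.card_pos
  have hTpos : (0 : ℝ) < T.card := Nat.cast_pos.2 hTne.card_pos
  refine sub_le_sub_left ?_ 1
  rw [div_le_div_iff₀ hTpos hSpos]
  exact_mod_cast hcount

/-! ### Hyperplane sections of an affine variety -/

theorem affineForm_eq {n : ℕ} (c : Fin (n + 1) → ℂ) :
    affineForm c = linearForm n (fun i => c i.succ) + C (c 0) := by
  rw [affineForm, linearForm_apply, add_comm]

theorem IsAffineVariety.zeroLocus_vanishingIdeal {n : ℕ} {V : Set (Fin n → ℂ)}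
    (hV : IsAffineVariety V) : zeroLocus ℂ (vanishingIdeal ℂ V) = V := by
  obtain ⟨I, rfl⟩ := hV
  exact le_antisymm (zeroLocus_anti_mono (le_vanishingIdeal_zeroLocus I))
    (zeroLocus_vanishingIdeal_le _)

theorem ringKrullDim_coordRing_inter {n : ℕ} {V : Set (Fin n → ℂ)}
    (hV : IsAffineVariety V) (c : Fin (n + 1) → ℂ) :
    ringKrullDim (CoordRing (V ∩ affineHyperplane c)) =
      ringKrullDim (MvPolynomial (Fin n) ℂ ⧸
        (vanishingIdeal ℂ V ⊔ Ideal.span {affineForm c})) := by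
  have h : V ∩ affineHyperplane c =
      zeroLocus ℂ (vanishingIdeal ℂ V ⊔ Ideal.span {affineForm c}) := by
    conv_lhs => rw [← hV.zeroLocus_vanishingIdeal]
    ext x
    constructor
    · rintro ⟨hx, hxc⟩
      have hle : vanishingIdeal ℂ V ⊔ Ideal.span {affineForm c} ≤ vanishingIdeal ℂ {x} := by
        rw [sup_le_iff, Ideal.span_singleton_le_iff_mem]
        refine ⟨fun p hp => ?_, ?_⟩
        · rw [mem_vanishingIdeal_singleton_iff]; exact hx p hp
        · rw [mem_vanishingIdeal_singleton_iff]; exact hxc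
      intro p hp
      exact (mem_vanishingIdeal_singleton_iff x p).1 (hle hp)
    · intro hx
      refine ⟨fun p hp => hx p (Ideal.mem_sup_left hp), ?_⟩
      exact hx _ (Ideal.mem_sup_right (Ideal.mem_span_singleton_self _))
  change ringKrullDim (MvPolynomial (Fin n) ℂ ⧸ vanishingIdeal ℂ (V ∩ affineHyperplane c)) = _
  rw [h, vanishingIdeal_zeroLocus_eq_radical, ringKrullDim_quotient_radical]

theorem affineDim_of_ringKrullDim_eq {n : ℕ} {V : Set (Fin n → ℂ)} {d : ℕ}
    (h : ringKrullDim (CoordRing V) = d) : affineDim V = d := by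
  refine (ringKrullDim_coordRing ?_ d).2 h
  rw [Set.nonempty_iff_ne_empty]
  rintro rfl
  have : Subsingleton (CoordRing (∅ : Set (Fin n → ℂ))) := by
    rw [CoordRing, vanishingIdeal_empty]
    exact Ideal.Quotient.subsingleton_iff.2 rfl
  rw [ringKrullDim_eq_bot_of_subsingleton] at h
  exact WithBot.bot_ne_coe h

theorem affineDim_of_ringKrullDim_eq_bot {n : ℕ} {V : Set (Fin n → ℂ)}
    (h : ringKrullDim (CoordRing V) = ⊥) : affineDim V = -1 := by
  by_contra hne
  have hV : V.Nonempty := by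
    rw [Set.nonempty_iff_ne_empty]
    rintro rfl
    exact hne (by simp [affineDim])
  have h1 := (ringKrullDim_coordRing hV (affineDim V).toNat).1 (by
    rw [Int.toNat_of_nonneg]
    rw [affineDim, if_neg hV.ne_empty]
    positivity)
  rw [h] at h1
  exact WithBot.bot_ne_coe h1

/-- The minimal primes of `J` of dimension `δ`. -/
noncomputable def Ideal.minimalPrimesOfDim {R : Type*} [CommRing R] [IsNoetherianRing R]
    (J : Ideal R) (δ : ℕ) : Finset (Ideal R) :=
  open Classical in
  J.finite_minimalPrimes_of_isNoetherianRing.toFinset.filter fun Q => ringKrullDim (R ⧸ Q) = δ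

theorem mem_minimalPrimesOfDim {R : Type*} [CommRing R] [IsNoetherianRing R]
    {J Q : Ideal R} {δ : ℕ} :
    Q ∈ J.minimalPrimesOfDim δ ↔ Q ∈ J.minimalPrimes ∧ ringKrullDim (R ⧸ Q) = δ := by
  simp [Ideal.minimalPrimesOfDim]

theorem card_minimalPrimesOfDim_le_affineDegree {n δ : ℕ} {V : Set (Fin n → ℂ)}
    (hδ : affineDim V = δ) (hdim : ringKrullDim (CoordRing V) = δ)
    {J : Ideal (MvPolynomial (Fin n) ℂ)} (hJ : ∀ s, J.hilbertFn s ≤ hilbertFn V s) :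
    ((J.minimalPrimesOfDim δ).card : ℝ) ≤ affineDegree V := by
  obtain ⟨C, hC⟩ := exists_hilbertFn_le (vanishingIdeal ℂ V) hdim
  rw [affineDegree, hδ, Int.toNat_natCast]
  refine card_le_limsup_of_hilbertFn_le (J := J) (C := C) _ ?_ ?_ ?_ ?_ hJ hC
  · exact fun Q hQ => (mem_minimalPrimesOfDim.1 hQ).1.1.1
  · exact fun Q hQ => (mem_minimalPrimesOfDim.1 hQ).1.1.2
  · intro Q hQ Q' hQ' hle
    exact le_antisymm hle ((mem_minimalPrimesOfDim.1 hQ').1.2 (mem_minimalPrimesOfDim.1 hQ).1.1 hle)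
  · exact fun Q hQ => (mem_minimalPrimesOfDim.1 hQ).2

/-- For `δ ≥ 1` the subspaces are given by the vanishing of the linear part of the affine form on a
top-dimensional component of the cone of points at infinity, for `δ = 0` by the vanishing of the
affine form at a point of `V`. -/
theorem exists_bad_subspaces {n δ : ℕ} {V : Set (Fin n → ℂ)} (hV : IsAffineVariety V)
    (hδ : affineDim V = δ) :
    ∃ F : Finset (Submodule ℂ (Fin (n + 1) → ℂ)), ⊤ ∉ F ∧ (F.card : ℝ) ≤ affineDegree V ∧
      ∀ c, (∀ U ∈ F, c ∉ U) → affineDim (V ∩ affineHyperplane c) = (δ : ℤ) - 1 := by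
  classical
  have hne : V.Nonempty := by
    rw [Set.nonempty_iff_ne_empty]
    rintro rfl
    simp only [affineDim, if_true] at hδ
    omega
  have hdim := (ringKrullDim_coordRing hne δ).1 hδ
  set I := vanishingIdeal ℂ V with hI
  -- the linear part of the affine form with coefficients `c`, and the form itself
  let ℓ : (Fin (n + 1) → ℂ) →ₗ[ℂ] MvPolynomial (Fin n) ℂ :=
    (linearForm n).comp (LinearMap.funLeft ℂ ℂ Fin.succ)
  let h : (Fin (n + 1) → ℂ) →ₗ[ℂ] MvPolynomial (Fin n) ℂ :=
    ℓ + (Algebra.linearMap ℂ _).comp (LinearMap.proj 0)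
  have hh : ∀ c, h c = affineForm c := fun c => (affineForm_eq c).symm
  cases δ with
  | zero =>
    refine ⟨(I.minimalPrimesOfDim 0).image fun Q => (Q.restrictScalars ℂ).comap h, ?_, ?_, ?_⟩
    · intro ht
      obtain ⟨Q, hQ, hQt⟩ := Finset.mem_image.1 ht
      have h1 : Pi.single 0 1 ∈ (Q.restrictScalars ℂ).comap h := by rw [hQt]; trivial
      have h2 : h (Pi.single 0 1) = 1 := by
        rw [hh, affineForm]; simp
      rw [Submodule.mem_comap, h2] at h1
      exact (mem_minimalPrimesOfDim.1 hQ).1.1.1.ne_top ((Ideal.eq_top_iff_one Q).2 h1)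
    · refine le_trans ?_ (card_minimalPrimesOfDim_le_affineDegree hδ hdim (J := I) fun s => le_rfl)
      exact_mod_cast Finset.card_image_le
    · intro c hc
      have htop : I ⊔ Ideal.span {affineForm c} = ⊤ := by
        by_contra hlt
        obtain ⟨M, hM, hle⟩ := Ideal.exists_le_maximal _ hlt
        rw [sup_le_iff, Ideal.span_singleton_le_iff_mem] at hle
        obtain ⟨Q, hQ, hQM⟩ := Ideal.exists_minimalPrimes_le hle.1
        have := hQ.1.1
        have hQ0 : ringKrullDim (MvPolynomial (Fin n) ℂ ⧸ Q) ≤ (0 : ℕ) :=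
          (ringKrullDim_quotient_anti hQ.1.2).trans hdim.le
        have hQF : affineForm c ∉ Q := fun hcQ => by
          have hQd := le_antisymm hQ0 ringKrullDim_nonneg_of_nontrivial
          refine hc _ (Finset.mem_image_of_mem _ (mem_minimalPrimesOfDim.2 ⟨hQ, hQd⟩)) ?_
          rw [Submodule.mem_comap, hh]
          exact hcQ
        have hlt : Q < M := lt_of_le_of_ne hQM fun h => hQF (h ▸ hle.2)
        have h1 := (ringKrullDim_quotient_add_one_le_of_lt hlt).trans hQ0
        have hM0 : (0 : WithBot ℕ∞) ≤ ringKrullDim (MvPolynomial (Fin n) ℂ ⧸ M) :=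
          ringKrullDim_nonneg_of_nontrivial
        have h2 : (0 : WithBot ℕ∞) + 1 ≤ (0 : ℕ) := (add_le_add_left hM0 1).trans h1
        have h3 : (0 : ℕ) + 1 ≤ 0 := by exact_mod_cast h2
        omega
      have hbot := ringKrullDim_coordRing_inter hV c
      rw [← hI, htop, ringKrullDim_eq_bot_of_subsingleton
        (R := MvPolynomial (Fin n) ℂ ⧸ (⊤ : Ideal (MvPolynomial (Fin n) ℂ)))] at hbot
      simpa using affineDim_of_ringKrullDim_eq_bot hbot
  | succ d =>
    refine ⟨(I.initialForms.minimalPrimesOfDim (d + 1)).image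
      fun Q => (Q.restrictScalars ℂ).comap ℓ, ?_, ?_, ?_⟩
    · intro ht
      obtain ⟨Q, hQ, hQt⟩ := Finset.mem_image.1 ht
      have := (mem_minimalPrimesOfDim.1 hQ).1.1.1
      obtain ⟨i, hi⟩ := exists_X_notMem_of_ringKrullDim_pos (mem_minimalPrimesOfDim.1 hQ).2
      have h1 : Pi.single i.succ 1 ∈ (Q.restrictScalars ℂ).comap ℓ := by rw [hQt]; trivial
      have h2 : ℓ (Pi.single i.succ 1) = X i := by
        rw [← linearForm_single]
        change linearForm n _ = _
        congr 1
        ext j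
        simp [LinearMap.funLeft_apply, Pi.single_apply]
      rw [Submodule.mem_comap, h2] at h1
      exact hi h1
    · refine le_trans ?_ (card_minimalPrimesOfDim_le_affineDegree hδ hdim
        (J := I.initialForms) fun s => hilbertFn_initialForms_le I s)
      exact_mod_cast Finset.card_image_le
    · intro c hc
      have h1 := ringKrullDim_quotient_sup_span_linearForm_add_C hdim (c := fun i => c i.succ)
        (fun Q hQ hQd hcQ => hc _ (Finset.mem_image_of_mem _
          (mem_minimalPrimesOfDim.2 ⟨hQ, hQd⟩)) hcQ) (c 0)
      rw [← affineForm_eq, ← ringKrullDim_coordRing_inter hV c] at h1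
      rw [affineDim_of_ringKrullDim_eq h1]
      push_cast
      ring

theorem proposition5p1 {n : ℕ} (V : Set (Fin n → ℂ)) (hV : IsAffineVariety V)
    (δ : ℕ) (hδ : affineDim V = δ) (D : ℝ) (hD : affineDegree V = D) :
    (∀ S : Finset ℂ, S.Nonempty → (0 : ℂ) ∉ S →
      1 - D / S.card ≤
        (randomCoeffs n S).real {c | affineDim (V ∩ affineHyperplane c) = (δ : ℤ) - 1}) ∧
    (∀ κ : ℝ, 2 ≤ κ → ∃ c : Fin (n + 1) → ℤ,
      (∀ i, bitsize (c i) = ⌈Real.logb 2 (2 * κ * D)⌉₊ + 1) ∧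
      affineDim (V ∩ affineHyperplane fun i => (c i : ℂ)) = (δ : ℤ) - 1) := by
  classical
  obtain ⟨F, hF, hFD, hgood⟩ := exists_bad_subspaces hV hδ
  rw [hD] at hFD
  refine ⟨fun S hS _ => ?_, fun κ hκ => ?_⟩
  · refine le_trans ?_ (one_sub_card_div_card_le_randomCoeffs hS F hF hgood)
    gcongr
  · set b := ⌈Real.logb 2 (2 * κ * D)⌉₊ with hb
    let S : Finset ℂ := (Finset.Ico (2 ^ b) (2 ^ (b + 1)) : Finset ℕ).map Nat.castEmbedding
    have hcard : S.card = 2 ^ b := by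
      rw [Finset.card_map, Nat.card_Ico, pow_succ]; omega
    have hS : S.Nonempty := Finset.card_pos.1 (by rw [hcard]; positivity)
    -- an empty `F` needs no bound; otherwise `D ≥ 1`, and the logarithm is not a junk value
    have hlt : F.card < S.card := by
      rcases F.card.eq_zero_or_pos with h0 | hpos
      · rw [h0]; exact hS.card_pos
      have hDpos : 1 ≤ D := le_trans (by exact_mod_cast hpos) hFD
      have h1 : 2 * κ * D ≤ 2 ^ (b : ℝ) := by
        rw [← Real.logb_le_iff_le_rpow (by norm_num) (by positivity)]
        exact Nat.le_ceil _
      rw [Real.rpow_natCast] at h1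
      have h2 : (F.card : ℝ) < (2 ^ b : ℝ) := by nlinarith
      rw [hcard]
      exact_mod_cast h2
    obtain ⟨c, hcS, hcF⟩ : ∃ c ∈ Fintype.piFinset fun _ : Fin (n + 1) => S, ∀ U ∈ F, c ∉ U := by
      by_contra! hall
      have hcount := card_filter_exists_mem_mul_card_le S F hF
      rw [Finset.filter_true_of_mem hall, mul_comm] at hcount
      exact absurd (Nat.le_of_mul_le_mul_right hcount
        (Fintype.piFinset_nonempty.2 fun _ => hS).card_pos) (by omega)
    rw [Fintype.mem_piFinset] at hcS
    choose a ha hac using fun i => Finset.mem_map.1 (hcS i)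
    refine ⟨fun i => a i, fun i => ?_, ?_⟩
    · have hai := Finset.mem_Ico.1 (ha i)
      rw [bitsize, Int.natAbs_natCast]
      exact le_antisymm (Nat.size_le.2 hai.2) (Nat.lt_size.2 hai.1)
    · have hca : (fun i => ((a i : ℤ) : ℂ)) = c := by
        funext i
        rw [← hac i]; simp
      rw [hca]
      exact hgood c hcF
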